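/- **Setting.** Formulas are built from countably many variables with the connectives $\neg,\to$; put $\varphi\oplus\psi=\neg\varphi\to\psi$, $\varphi\wedge\psi=\neg((\neg\varphi\to\neg\psi)\to\neg\psi)$, and let $j\varphi$ be $\varphi\oplus\dots\oplus\varphi$ ($j$ times). A *logic* is a structural (substitution-invariant) consequence relation $\vdash$ on formulas; logics are ordered by inclusion, $L_1\cap L_2$ is the intersection of the consequence relations, and $L$ is *finitary* if $\Gamma\vdash_L\varphi$ implies $\Delta\vdash_L\varphi$ for some finite $\Delta\subseteq\Gamma$. A matrix $\langle\mathbf A,F\rangle$ defines the logic in which $\Gamma\vdash\varphi$ iff every evaluation in $\mathbf A$ that sends $\Gamma$ into $F$ sends $\varphi$ into $F$. Let $\mathbf{LV}_{m+1}$ be $\{0,\frac1m,\dots,\frac{m-1}m,1\}$ with $\neg x=1-x$ and $x\to y=\min\{1,1-x+y\}$. For positive integers $m$, $a\le b$ let $$\mathsf L^{a/b}_m=\langle \mathbf{LV}_{m+1},\{x: x\ge a/b\}\rangle,\qquad \bar{\mathsf L}^{a/b}_m=\langle \mathbf{LV}_{m+1}\times\mathbf{LV}_2,\{(x,1): x\ge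 a/b\}\rangle,\qquad \mathsf L^i_n=\mathsf L^{i/n}_n .$$ $L_1$ is *strongly maximal* with respect to $L_2$ if $L_1\subsetneq L_2$ and, for every finitary rule $\varphi_1,\dots,\varphi_s/\psi$ valid in $L_2$ but not in $L_1$, the least logic that extends $L_1$ and validates all substitution instances of this rule is $L_2$. A formula $\gamma$ in one variable *axiomatizes* $L$ relative to $B$ if $L$ is the least logic that extends $B$ and has all substitution instances of $\gamma$ as theorems. A *Hilbert calculus* is a set of schematic finitary rules (axioms are rules without premises). **Theorem.** Let $0<i\le n$ be integers. 1. Let $q$ be a prime with $q\nmid n$, let $(i-1)q<j\le iq$, and put $m=q$. Then $\mathsf L^i_n\cap\bar{\mathsf L}^{j/nq}_{m}$ is strongly maximal with respect to $\mathsf L^i_n$. Moreover, there are a finite Hilbert calculus that is sound and complete for $\mathsf L^j_{nq}$, a formula in one variable that axiomatizes $\mathsf L^{j/nq}_n\cap\mathsf L^{j/nq}_m$ relative to $\mathsf L^j_{nq}$, and a formula in one variable that axiomatizes $\mathsf L^{j/nq}_n$ relative to $\mathsf L^j_{nq}$; and for every Hilbert calculus $\mathsf H$ that is sound and complete for $\mathsf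 L^j_{nq}$, every such formula $\gamma_{n,m}$ for $\mathsf L^{j/nq}_n\cap\mathsf L^{j/nq}_m$, and every such formula $\gamma_n$ for $\mathsf L^{j/nq}_n$, the logic $\mathsf L^i_n\cap\bar{\mathsf L}^{j/nq}_{m}$ is axiomatized by $\mathsf H$ plus the axiom $\gamma_{n,m}$ plus the rule $j(\varphi\wedge\neg\varphi)/\gamma_n(\psi)$. 2. Let $q$ be a prime and $r\ge 0$ with $q^r\mid n$ and $q^{r+1}\nmid n$, let $(i-1)q<j\le iq$, and put $m=q^{r+1}$. Then all the conclusions of 1 hold for $\mathsf L^i_n\cap\bar{\mathsf L}^{j/nq}_{m}$. 3. Let $L$ be a finitary logic that extends $\mathsf L^{j}_{k}$ for some integers $0<j\le k$. Then $L$ is strongly maximal with respect to $\mathsf L^i_n$ if and only if $L$ is one of the logics described in 1 and 2, for some prime $q$ and some $j$ with $(i-1)q<j\le iq$. -/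

import Mathlib

namespace Luk

/-! ### Formulas, substitutions, rules -/

/-- Formulas over the signature `{¬, →}` with variables `p₀, p₁, p₂, …`. -/
inductive Fm : Type
  | var : ℕ → Fm
  | neg : Fm → Fm
  | imp : Fm → Fm → Fm

namespace Fm

/-- Simultaneous substitution of formulas for variables. -/
def subst (σ : ℕ → Fm) : Fm → Fm
  | var k => σ k
  | neg φ => neg (subst σ φ)
  | imp φ ψ => imp (subst σ φ) (subst σ ψ)

/-- The set of variables that occur in a formula. -/
def vars : Fm → Set ℕ
  | var k => {k}
  | neg φ => vars φ
  | imp φ ψ => vars φ ∪ vars ψ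

/-- Strong disjunction `φ ⊕ ψ = ¬φ → ψ`. -/
def oplus (φ ψ : Fm) : Fm := imp (neg φ) ψ

/-- Lattice conjunction `φ ∧ ψ = ¬((¬φ → ¬ψ) → ¬ψ)`. -/
def meet (φ ψ : Fm) : Fm := neg (imp (imp (neg φ) (neg ψ)) (neg ψ))

/-- `nmul k φ = φ ⊕ ⋯ ⊕ φ` (`k` times); the empty sum is the falsum `¬(φ → φ)`. -/
def nmul : ℕ → Fm → Fm
  | 0, φ => neg (imp φ φ)
  | 1, φ => φ
  | k + 2, φ => oplus (nmul (k + 1) φ) φ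

theorem subst_subst (σ τ : ℕ → Fm) (φ : Fm) :
    subst σ (subst τ φ) = subst (fun k => subst σ (τ k)) φ := by
  induction φ with
  | var k => rfl
  | neg φ ih => simp [subst, ih]
  | imp φ ψ ih₁ ih₂ => simp [subst, ih₁, ih₂]

end Fm

/-- A finitary rule `φ₁, …, φₙ / ψ`, read schematically. -/
structure Rule where
  prems : List Fm
  concl : Fm

/-- An axiom, that is, a rule without premises. -/
def Rule.ax (φ : Fm) : Rule := ⟨[], φ⟩

/-! ### Logics -/

/-- A propositional logic: a structural consequence relation on formulas. -/
@[ext]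
structure Logic where
  Deriv : Set Fm → Fm → Prop
  refl' : ∀ Γ φ, φ ∈ Γ → Deriv Γ φ
  cut' : ∀ Γ Δ φ, (∀ δ ∈ Δ, Deriv Γ δ) → Deriv Δ φ → Deriv Γ φ
  structural' : ∀ (σ : ℕ → Fm) Γ φ, Deriv Γ φ → Deriv (Fm.subst σ '' Γ) (Fm.subst σ φ)

namespace Logic

/-- `L₁ ≤ L₂`: `L₁` is a sublogic of `L₂` (and `L₂` an extension of `L₁`). -/
instance : PartialOrder Logic where
  le L₁ L₂ := ∀ Γ φ, L₁.Deriv Γ φ → L₂.Deriv Γ φ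
  le_refl _ _ _ h := h
  le_trans _ _ _ h₁ h₂ Γ φ h := h₂ Γ φ (h₁ Γ φ h)
  le_antisymm L₁ L₂ h₁ h₂ := by
    ext Γ φ
    exact ⟨h₁ Γ φ, h₂ Γ φ⟩

/-- The intersection of two logics, `L₁ ⊓ L₂`. -/
instance : Min Logic where
  min L₁ L₂ :=
    { Deriv := fun Γ φ => L₁.Deriv Γ φ ∧ L₂.Deriv Γ φ
      refl' := fun Γ φ h => ⟨L₁.refl' Γ φ h, L₂.refl' Γ φ h⟩
      cut' := fun Γ Δ φ h₁ h₂ =>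
        ⟨L₁.cut' Γ Δ φ (fun δ hδ => (h₁ δ hδ).1) h₂.1,
          L₂.cut' Γ Δ φ (fun δ hδ => (h₁ δ hδ).2) h₂.2⟩
      structural' := fun σ Γ φ h => ⟨L₁.structural' σ Γ φ h.1, L₂.structural' σ Γ φ h.2⟩ }

/-- A logic is finitary if every consequence follows from finitely many premises. -/
def Finitary (L : Logic) : Prop :=
  ∀ Γ φ, L.Deriv Γ φ → ∃ Δ : Set Fm, Δ ⊆ Γ ∧ Δ.Finite ∧ L.Deriv Δ φ

/-- The rule `r` is valid in `L`. -/
def Validates (L : Logic) (r : Rule) : Prop := L.Deriv {φ | φ ∈ r.prems} r.concl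

/-- The least logic that extends `L` and in which all rules from `R` are valid
(hence, by structurality, also all their substitution instances). -/
def adjoin (L : Logic) (R : Set Rule) : Logic where
  Deriv Γ φ := ∀ L' : Logic, L ≤ L' → (∀ r ∈ R, L'.Validates r) → L'.Deriv Γ φ
  refl' Γ φ h L' _ _ := L'.refl' Γ φ h
  cut' Γ Δ φ h₁ h₂ L' hL hR :=
    L'.cut' Γ Δ φ (fun δ hδ => h₁ δ hδ L' hL hR) (h₂ L' hL hR)
  structural' σ Γ φ h L' hL hR := L'.structural' σ Γ φ (h L' hL hR)

/-- `L₁` is strongly maximal with respect to `L₂`: it is a proper sublogic of `L₂`, and the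
addition to `L₁` of any finitary rule that is valid in `L₂` but not in `L₁` yields `L₂`. -/
def StronglyMaximal (L₁ L₂ : Logic) : Prop :=
  L₁ < L₂ ∧ ∀ r : Rule, L₂.Validates r → ¬ L₁.Validates r → L₁.adjoin {r} = L₂

end Logic

/-! ### Hilbert calculi -/

/-- `HilbertDeriv H Γ φ`: there is a derivation of `φ` from the hypotheses `Γ` in the Hilbert
calculus whose axiom schemes and rule schemes are the members of `H`. -/
inductive HilbertDeriv (H : Set Rule) (Γ : Set Fm) : Fm → Prop
  | hyp (φ : Fm) : φ ∈ Γ → HilbertDeriv H Γ φ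
  | rule (r : Rule) (σ : ℕ → Fm) : r ∈ H →
      (∀ φ ∈ r.prems, HilbertDeriv H Γ (Fm.subst σ φ)) → HilbertDeriv H Γ (Fm.subst σ r.concl)

/-- The logic defined by a Hilbert calculus. -/
def hilbertLogic (H : Set Rule) : Logic where
  Deriv := HilbertDeriv H
  refl' Γ φ h := HilbertDeriv.hyp φ h
  cut' Γ Δ φ h₁ h₂ := by
    induction h₂ with
    | hyp φ h => exact h₁ φ h
    | rule r σ hr _ ih => exact HilbertDeriv.rule r σ hr ih
  structural' σ Γ φ h := by
    induction h with
    | hyp φ h => exact HilbertDeriv.hyp _ ⟨φ, h, rfl⟩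
    | rule r τ hr _ ih =>
      rw [Fm.subst_subst]
      refine HilbertDeriv.rule r _ hr fun φ hφ => ?_
      rw [← Fm.subst_subst]
      exact ih φ hφ

/-! ### Algebras and matrix logics -/

/-- Algebras over the signature `{¬, →}`. -/
class Alg (A : Type) where
  neg : A → A
  imp : A → A → A

/-- The homomorphism from the formula algebra to `A` that extends the assignment `e`. -/
def eval {A : Type} [Alg A] (e : ℕ → A) : Fm → A
  | Fm.var k => e k
  | Fm.neg φ => Alg.neg (eval e φ)
  | Fm.imp φ ψ => Alg.imp (eval e φ) (eval e ψ)

theorem eval_subst {A : Type} [Alg A] (e : ℕ → A) (σ : ℕ → Fm) (φ : Fm) :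
    eval e (Fm.subst σ φ) = eval (fun k => eval e (σ k)) φ := by
  induction φ with
  | var k => rfl
  | neg φ ih => simp [Fm.subst, eval, ih]
  | imp φ ψ ih₁ ih₂ => simp [Fm.subst, eval, ih₁, ih₂]

/-- The logic of the matrix `⟨A, F⟩`. -/
def matrixLogic (A : Type) [Alg A] (F : Set A) : Logic where
  Deriv Γ φ := ∀ e : ℕ → A, (∀ ψ ∈ Γ, eval e ψ ∈ F) → eval e φ ∈ F
  refl' Γ φ h e he := he φ h
  cut' Γ Δ φ h₁ h₂ e he := h₂ e fun δ hδ => h₁ δ hδ e he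
  structural' σ Γ φ h e he := by
    rw [eval_subst]
    refine h _ fun ψ hψ => ?_
    rw [← eval_subst]
    exact he _ ⟨ψ, hψ, rfl⟩

/-- The direct product of two algebras. -/
instance {A B : Type} [Alg A] [Alg B] : Alg (A × B) where
  neg x := (Alg.neg x.1, Alg.neg x.2)
  imp x y := (Alg.imp x.1 y.1, Alg.imp x.2 y.2)

/-- The domain `{0, 1/n, …, (n-1)/n, 1}` of the `(n+1)`-valued Łukasiewicz algebra, for `n ≥ 1`,
as the set of the rationals `x` in the unit interval such that `n x` is an integer. -/
def LV (n : ℕ) : Type := {x : ℚ // 0 ≤ x ∧ x ≤ 1 ∧ ∃ a : ℤ, (n : ℚ) * x = a}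

theorem LV_mem_iff {n : ℕ} (hn : 0 < n) (x : ℚ) :
    (0 ≤ x ∧ x ≤ 1 ∧ ∃ a : ℤ, (n : ℚ) * x = a) ↔ ∃ a : ℕ, a ≤ n ∧ x = (a : ℚ) / n := by
  have hn' : (0 : ℚ) < n := by exact_mod_cast hn
  constructor
  · rintro ⟨h0, h1, a, ha⟩
    have ha0 : (0 : ℤ) ≤ a := by
      have : (0 : ℚ) ≤ a := by rw [← ha]; positivity
      exact_mod_cast this
    lift a to ℕ using ha0
    refine ⟨a, ?_, ?_⟩
    · have : (a : ℚ) ≤ n := by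
        have := mul_le_mul_of_nonneg_left h1 hn'.le
        rw [ha] at this
        simpa using this
      exact_mod_cast this
    · rw [eq_div_iff hn'.ne', mul_comm]
      simpa using ha
  · rintro ⟨a, ha, rfl⟩
    have ha' : (a : ℚ) ≤ n := by exact_mod_cast ha
    refine ⟨by positivity, (div_le_one hn').2 ha', a, ?_⟩
    field_simp
    simp

/-- The operations `¬x = 1 - x` and `x → y = min {1, 1 - x + y}`. -/
instance (n : ℕ) : Alg (LV n) where
  neg x := ⟨1 - x.1, by
    obtain ⟨x, h0, h1, a, ha⟩ := x
    refine ⟨by simpa using h1, by simpa using h0, (n : ℤ) - a, ?_⟩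
    push_cast
    rw [← ha]
    ring⟩
  imp x y := ⟨min 1 (1 - x.1 + y.1), by
    obtain ⟨x, hx0, hx1, a, ha⟩ := x
    obtain ⟨y, hy0, hy1, b, hb⟩ := y
    refine ⟨le_min zero_le_one (by simp only; linarith), min_le_left _ _, ?_⟩
    rcases min_choice (1 : ℚ) (1 - x + y) with h | h
    · exact ⟨n, by simp only [h]; simp⟩
    · refine ⟨(n : ℤ) - a + b, ?_⟩
      simp only [h]
      push_cast
      rw [← ha, ← hb]
      ring⟩

/-- The order filter `F_c = {x ∈ LV n : x ≥ c}`. -/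
def orderFilter (n : ℕ) (c : ℚ) : Set (LV n) := {x | c ≤ x.1}

/-- `lukAt m c` is the logic of the matrix with algebra `LV m` and with the designated
elements `x ≥ c`; for `c = i/n` it is written `L^{i/n}_m`. -/
def lukAt (m : ℕ) (c : ℚ) : Logic := matrixLogic (LV m) (orderFilter m c)

/-- The logic `L^i_n`. -/
def luk (n i : ℕ) : Logic := lukAt n ((i : ℚ) / n)

/-- `lukBarAt m c` is the logic of the matrix with algebra `LV m × LV 1` (`LV 1` has the domain
`{0, 1}`) and with the designated elements `(x, 1)` for `x ≥ c`; for `c = i/n` it is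
written `L̄^{i/n}_m`. -/
def lukBarAt (m : ℕ) (c : ℚ) : Logic :=
  matrixLogic (LV m × LV 1) (orderFilter m c ×ˢ {y : LV 1 | y.1 = 1})

/-! ### Axiomatizations -/

/-- `γ` is a formula in the single variable `p₀` that, added as an axiom to `B`, yields `L`. -/
def IsAxiomFor (B L : Logic) (γ : Fm) : Prop :=
  γ.vars ⊆ {0} ∧ B.adjoin {Rule.ax γ} = L

/-- The rule `j(φ ∧ ¬φ) / γ(ψ)`, for a formula `γ` in the variable `p₀`. -/
def explosionRule (j : ℕ) (γ : Fm) : Rule :=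
  ⟨[Fm.nmul j (Fm.meet (Fm.var 0) (Fm.neg (Fm.var 0)))], γ.subst fun _ => Fm.var 1⟩

/-- With `c = j/(nq)`: there are a finite Hilbert calculus that is sound and complete for
`L^j_{nq}` and formulas in one variable that axiomatize `L^c_n ∩ L^c_m` and `L^c_n` relative to
`L^j_{nq}`; and `L` is axiomatized by any Hilbert calculus `H` that is sound and complete for
`L^j_{nq}`, together with any such axiom `γ'` for `L^c_n ∩ L^c_m` and with the rule
`j(φ ∧ ¬φ) / γ(ψ)`, where `γ` is any such axiom for `L^c_n`. -/
def AxiomatizedWithExplosion (L : Logic) (n q m j : ℕ) : Prop :=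
  let c : ℚ := (j : ℚ) / ((n * q : ℕ) : ℚ)
  let B : Logic := luk (n * q) j
  (∃ H : Set Rule, H.Finite ∧ hilbertLogic H = B) ∧
  (∃ γ' : Fm, IsAxiomFor B (lukAt n c ⊓ lukAt m c) γ') ∧
  (∃ γ : Fm, IsAxiomFor B (lukAt n c) γ) ∧
  ∀ (H : Set Rule) (γ' γ : Fm), hilbertLogic H = B →
    IsAxiomFor B (lukAt n c ⊓ lukAt m c) γ' → IsAxiomFor B (lukAt n c) γ →
    hilbertLogic (H ∪ {Rule.ax γ', explosionRule j γ}) = L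

end Luk

open Luk

namespace Luk

/-! ### Valuations in the rationals -/

/-! Everything is decided by counterexamples, that is, by valuations `e` in a finite grid `Grid N`,
where N = nq and c = j/N. Under such an `e` the values of all formulas form `Grid M` for some M
dividing N, and one formula `t` takes the value 1/M (`exists_generator`). Every subset of the grid
has a 0/1-valued characteristic formula (`exists_char`). By `deriv_of_refuting`, an extension of
`lukAt N c` derives a rule as soon as each counterexample in the grid is refuted by some consequence
of the premises.

A counterexample to a rule of `lukAt n c` has M ∤ n, and then m = q^(r+1) divides M. Suppose a logic
validates a rule that fails in `lukBarAt m c` at a pair (e₁, e₂) in its first coordinate. Some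
substitution turns points with t = 1/M into e₁ and all other points into the Boolean e₂. The
premises then hold everywhere, so the conclusion becomes a theorem, and `e` refutes it
(`exists_refuted_theorem`). This gives strong maximality. The Boolean factor of the bar matrix
supplies exactly the harmless values away from the chosen points.

For the converse, a strongly maximal L has a rule of `luk n i` that it does not derive, hence an
unrefuted counterexample, whose M is divisible by such a q^(r+1). The same substitution argument
puts L below the corresponding intersection, and maximality forces equality.

For the axiomatization, the axiom leaves only counterexamples with M = m. For these, the premises of
a rule valid in the bar matrix have no Boolean model, so they derive an instance of j(φ ∧ ¬φ), and
the rule yields an instance of γ that fails at the counterexample. The finite calculus is obtained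
by a Lindenbaum argument, with formulas that define designation and each truth value. -/

instance : Alg ℚ where
  neg x := 1 - x
  imp x y := min 1 (1 - x + y)

/-- The rationals `x` in the unit interval such that `d x` is an integer. -/
def Grid (d : ℕ) : Set ℚ := {x | 0 ≤ x ∧ x ≤ 1 ∧ ∃ a : ℤ, (d : ℚ) * x = a}

section Rat

variable {e : ℕ → ℚ} {φ ψ : Fm}

@[simp] theorem eval_rat_var (k : ℕ) : eval e (Fm.var k) = e k := rfl

@[simp] theorem eval_rat_neg : eval e (Fm.neg φ) = 1 - eval e φ := rfl

@[simp] theorem eval_rat_imp : eval e (Fm.imp φ ψ) = min 1 (1 - eval e φ + eval e ψ) := rfl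

theorem coe_eval {d : ℕ} (e : ℕ → LV d) (φ : Fm) :
    (eval e φ).1 = eval (fun k => (e k).1) φ := by
  induction φ with
  | var k => rfl
  | neg φ ih => rw [eval_rat_neg, ← ih]; rfl
  | imp φ ψ ih₁ ih₂ => rw [eval_rat_imp, ← ih₁, ← ih₂]; rfl

/-- The element of `LV d` with the given underlying rational. -/
def toLV {d : ℕ} {x : ℚ} (hx : x ∈ Grid d) : LV d := ⟨x, hx⟩

theorem coe_eval_toLV {d : ℕ} (he : ∀ k, e k ∈ Grid d) (φ : Fm) :
    (eval (fun k => toLV (he k)) φ).1 = eval e φ := coe_eval _ _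

theorem eval_mem_Grid {d : ℕ} (he : ∀ k, e k ∈ Grid d) (φ : Fm) : eval e φ ∈ Grid d := by
  rw [← coe_eval_toLV he]
  exact (eval (fun k => toLV (he k)) φ).2

theorem eval_mem_Icc (he : ∀ k, e k ∈ Set.Icc (0 : ℚ) 1) (φ : Fm) :
    eval e φ ∈ Set.Icc (0 : ℚ) 1 := by
  induction φ with
  | var k => exact he k
  | neg φ ih => simp only [eval_rat_neg, Set.mem_Icc] at *; constructor <;> linarith
  | imp φ ψ ih₁ ih₂ =>
    simp only [eval_rat_imp, Set.mem_Icc] at *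
    exact ⟨le_min zero_le_one (by linarith), min_le_left _ _⟩

theorem Grid_subset_Icc (d : ℕ) : Grid d ⊆ Set.Icc 0 1 := fun _ h => ⟨h.1, h.2.1⟩

theorem eval_nonneg (he : ∀ k, e k ∈ Set.Icc (0 : ℚ) 1) : 0 ≤ eval e φ := (eval_mem_Icc he φ).1

theorem eval_le_one (he : ∀ k, e k ∈ Set.Icc (0 : ℚ) 1) : eval e φ ≤ 1 := (eval_mem_Icc he φ).2

theorem eval_meet (he : ∀ k, e k ∈ Set.Icc (0 : ℚ) 1) :
    eval e (Fm.meet φ ψ) = min (eval e φ) (eval e ψ) := by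
  have h₁ := eval_mem_Icc he φ
  have h₂ := eval_mem_Icc he ψ
  simp only [Set.mem_Icc] at h₁ h₂
  simp only [Fm.meet, eval_rat_neg, eval_rat_imp]
  rcases le_total (eval e φ) (eval e ψ) with h | h
  · rw [min_eq_left h, min_eq_right (b := 1 - (1 - eval e φ) + (1 - eval e ψ)) (by linarith),
      min_eq_right (by linarith)]; ring
  · rw [min_eq_right h, min_eq_left (b := 1 - (1 - eval e φ) + (1 - eval e ψ)) (by linarith),
      min_eq_right (by linarith)]; ring

/-- Lattice disjunction `φ ∨ ψ = (φ → ψ) → ψ`. -/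
def Fm.join (φ ψ : Fm) : Fm := Fm.imp (Fm.imp φ ψ) ψ

theorem eval_join (he : ∀ k, e k ∈ Set.Icc (0 : ℚ) 1) :
    eval e (Fm.join φ ψ) = max (eval e φ) (eval e ψ) := by
  have h₁ := eval_mem_Icc he φ
  have h₂ := eval_mem_Icc he ψ
  simp only [Set.mem_Icc] at h₁ h₂
  simp only [Fm.join, eval_rat_imp]
  rcases le_total (eval e φ) (eval e ψ) with h | h
  · rw [max_eq_right h, min_eq_left (a := 1) (b := 1 - eval e φ + eval e ψ) (by linarith),
      min_eq_right (by linarith)]; ring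
  · rw [max_eq_left h, min_eq_right (a := 1) (b := 1 - eval e φ + eval e ψ) (by linarith),
      min_eq_right (by linarith)]; ring

theorem eval_nmul (he : ∀ k, e k ∈ Set.Icc (0 : ℚ) 1) (l : ℕ) :
    eval e (Fm.nmul l φ) = min 1 (l * eval e φ) := by
  have h₁ := eval_mem_Icc he φ
  simp only [Set.mem_Icc] at h₁
  induction l with
  | zero => simp [Fm.nmul]
  | succ l ih =>
    cases l with
    | zero => simp [Fm.nmul, h₁.2]
    | succ l =>
      simp only [Fm.nmul, Fm.oplus, eval_rat_imp, eval_rat_neg, ih]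
      push_cast
      rcases le_total 1 (((l : ℚ) + 1) * eval e φ) with h | h
      · rw [min_eq_left h, min_eq_left (by linarith), min_eq_left (by linarith)]
      · rw [min_eq_right h]
        congr 1
        ring

end Rat

theorem mem_Grid_iff {d : ℕ} (hd : 0 < d) {x : ℚ} :
    x ∈ Grid d ↔ ∃ a : ℕ, a ≤ d ∧ x = (a : ℚ) / d := LV_mem_iff hd x

theorem Grid_mono {d N : ℕ} (h : d ∣ N) : Grid d ⊆ Grid N := by
  rintro x ⟨h0, h1, a, ha⟩
  obtain ⟨l, rfl⟩ := h
  refine ⟨h0, h1, l * a, ?_⟩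
  push_cast
  rw [← ha]
  ring

theorem zero_mem_Grid (d : ℕ) : (0 : ℚ) ∈ Grid d := ⟨le_rfl, zero_le_one, 0, by simp⟩

theorem one_mem_Grid (d : ℕ) : (1 : ℚ) ∈ Grid d := ⟨zero_le_one, le_rfl, d, by simp⟩

theorem inv_mem_Grid_iff {d M : ℕ} (hM : 0 < M) : 1 / (M : ℚ) ∈ Grid d ↔ M ∣ d := by
  have hM' : (0 : ℚ) < M := by exact_mod_cast hM
  constructor
  · rintro ⟨_, _, a, ha⟩
    have h : (d : ℚ) = M * a := by rw [← ha]; field_simp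
    have h' : (d : ℤ) = M * a := by exact_mod_cast h
    exact Int.natCast_dvd_natCast.1 ⟨a, h'⟩
  · intro h
    have h1 : (1 : ℚ) ≤ M := by exact_mod_cast hM
    refine Grid_mono h ⟨by positivity, (div_le_one hM').2 h1, 1, ?_⟩
    field_simp
    simp

theorem mem_Grid_one {x : ℚ} : x ∈ Grid 1 ↔ x = 0 ∨ x = 1 := by
  constructor
  · intro h
    obtain ⟨a, ha, rfl⟩ := (mem_Grid_iff one_pos).1 h
    interval_cases a <;> simp
  · rintro (rfl | rfl)
    exacts [zero_mem_Grid 1, one_mem_Grid 1]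

/-! ### Matrix logics in terms of rational valuations -/

theorem lukAt_deriv {d : ℕ} {c : ℚ} {Γ : Set Fm} {φ : Fm} :
    (lukAt d c).Deriv Γ φ ↔ ∀ e : ℕ → ℚ, (∀ k, e k ∈ Grid d) →
      (∀ ψ ∈ Γ, c ≤ eval e ψ) → c ≤ eval e φ := by
  constructor
  · intro h e he hΓ
    have := h (fun k => toLV (he k))
      (fun ψ hψ => show c ≤ _ by rw [coe_eval_toLV]; exact hΓ ψ hψ)
    change c ≤ _ at this
    rwa [coe_eval_toLV] at this
  · intro h e hΓ
    change c ≤ _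
    rw [coe_eval]
    refine h _ (fun k => (e k).2) fun ψ hψ => ?_
    rw [← coe_eval]
    exact hΓ ψ hψ

theorem eval_prod_fst {A B : Type} [Alg A] [Alg B] (e : ℕ → A × B) (φ : Fm) :
    (eval e φ).1 = eval (fun k => (e k).1) φ := by
  induction φ with
  | var k => rfl
  | neg φ ih => simp only [eval, ← ih]; rfl
  | imp φ ψ ih₁ ih₂ => simp only [eval, ← ih₁, ← ih₂]; rfl

theorem eval_prod_snd {A B : Type} [Alg A] [Alg B] (e : ℕ → A × B) (φ : Fm) :
    (eval e φ).2 = eval (fun k => (e k).2) φ := by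
  induction φ with
  | var k => rfl
  | neg φ ih => simp only [eval, ← ih]; rfl
  | imp φ ψ ih₁ ih₂ => simp only [eval, ← ih₁, ← ih₂]; rfl

/-- For 0 < c ≤ 1 a Boolean value is 1 exactly when it is at least c, so both coordinates can share
one threshold. -/
theorem lukBarAt_deriv {m : ℕ} {c : ℚ} (hc0 : 0 < c) (hc1 : c ≤ 1) {Γ : Set Fm} {φ : Fm} :
    (lukBarAt m c).Deriv Γ φ ↔ ∀ e₁ e₂ : ℕ → ℚ, (∀ k, e₁ k ∈ Grid m) → (∀ k, e₂ k ∈ Grid 1) →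
      (∀ ψ ∈ Γ, c ≤ eval e₁ ψ ∧ c ≤ eval e₂ ψ) → c ≤ eval e₁ φ ∧ c ≤ eval e₂ φ := by
  have key : ∀ (e : ℕ → LV m × LV 1) (ψ : Fm),
      eval e ψ ∈ orderFilter m c ×ˢ {y : LV 1 | y.1 = 1} ↔
        c ≤ eval (fun k => (e k).1.1) ψ ∧ c ≤ eval (fun k => (e k).2.1) ψ := by
    intro e ψ
    rw [Set.mem_prod, eval_prod_fst, eval_prod_snd, ← coe_eval, ← coe_eval]
    refine and_congr Iff.rfl ?_
    change (eval (fun k => (e k).2) ψ).1 = 1 ↔ _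
    rcases mem_Grid_one.1 (eval (fun k => (e k).2) ψ).2 with h | h <;> rw [h]
    · simpa using hc0
    · simpa using hc1
  constructor
  · intro h e₁ e₂ he₁ he₂ hΓ
    exact (key (fun k => (toLV (he₁ k), toLV (he₂ k))) φ).1
      (h _ fun ψ hψ => (key _ ψ).2 (hΓ ψ hψ))
  · intro h e hΓ
    exact (key e φ).2 (h _ _ (fun k => (e k).1.2) (fun k => (e k).2.2)
      fun ψ hψ => (key e ψ).1 (hΓ ψ hψ))

theorem lukAt_le_lukAt {d N : ℕ} (h : d ∣ N) (c : ℚ) : lukAt N c ≤ lukAt d c := by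
  intro Γ φ hd
  rw [lukAt_deriv] at *
  exact fun e he => hd e fun k => Grid_mono h (he k)

theorem lukAt_le_lukBarAt {m N : ℕ} (h : m ∣ N) {c : ℚ} (hc0 : 0 < c) (hc1 : c ≤ 1) :
    lukAt N c ≤ lukBarAt m c := by
  intro Γ φ hd
  rw [lukAt_deriv] at hd
  rw [lukBarAt_deriv hc0 hc1]
  exact fun e₁ e₂ h₁ h₂ hΓ => ⟨hd e₁ (fun k => Grid_mono h (h₁ k)) fun ψ hψ => (hΓ ψ hψ).1,
    hd e₂ (fun k => Grid_mono (one_dvd N) (h₂ k)) fun ψ hψ => (hΓ ψ hψ).2⟩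

theorem lukAt_congr {d : ℕ} {c c' : ℚ} (h : ∀ x ∈ Grid d, c ≤ x ↔ c' ≤ x) :
    lukAt d c = lukAt d c' := by
  ext Γ φ
  rw [lukAt_deriv, lukAt_deriv]
  refine forall₂_congr fun e he => ?_
  rw [h _ (eval_mem_Grid he φ)]
  simp only [h _ (eval_mem_Grid he _)]

theorem lukBarAt_congr {m : ℕ} {c c' : ℚ} (hc0 : 0 < c) (hc1 : c ≤ 1) (hc0' : 0 < c')
    (hc1' : c' ≤ 1) (h : ∀ x ∈ Grid m, c ≤ x ↔ c' ≤ x) : lukBarAt m c = lukBarAt m c' := by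
  have h' : ∀ x ∈ Grid 1, c ≤ x ↔ c' ≤ x := fun x hx => h x (Grid_mono (one_dvd m) hx)
  ext Γ φ
  rw [lukBarAt_deriv hc0 hc1, lukBarAt_deriv hc0' hc1']
  refine forall₂_congr fun e₁ e₂ => forall₂_congr fun h₁ h₂ => ?_
  rw [h _ (eval_mem_Grid h₁ φ), h' _ (eval_mem_Grid h₂ φ)]
  simp only [h _ (eval_mem_Grid h₁ _), h' _ (eval_mem_Grid h₂ _)]

/-! ### Finitarity -/

theorem Logic.Deriv.mono {L : Logic} {Γ Δ : Set Fm} {φ : Fm} (h : L.Deriv Γ φ) (hs : Γ ⊆ Δ) :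
    L.Deriv Δ φ :=
  L.cut' Δ Γ φ (fun δ hδ => L.refl' Δ δ (hs hδ)) h

/-- Compactness of the space of valuations `ℕ → A` for discrete finite `A`: each formula depends
continuously on the valuation, so the conditions on premises and conclusion are closed. -/
theorem finitary_matrixLogic (A : Type) [Alg A] [Finite A] (F : Set A) :
    (matrixLogic A F).Finitary := by
  let _ : TopologicalSpace A := ⊥
  have : DiscreteTopology A := ⟨rfl⟩
  have hcont : ∀ φ : Fm, Continuous fun e : ℕ → A => eval e φ := by
    intro φ
    induction φ with
    | var k => exact continuous_apply k
    | neg φ ih => exact (continuous_of_discreteTopology (f := (Alg.neg : A → A))).comp ih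
    | imp φ ψ ih₁ ih₂ =>
      exact (continuous_of_discreteTopology (f := fun x : A × A => Alg.imp x.1 x.2)).comp
        (ih₁.prodMk ih₂)
  have hclosed : ∀ (φ : Fm) (S : Set A), IsClosed {e : ℕ → A | eval e φ ∈ S} := fun φ S =>
    (isClosed_discrete S).preimage (hcont φ)
  intro Γ φ h
  by_contra hne
  push Not at hne
  have hK : IsCompact {e : ℕ → A | eval e φ ∈ Fᶜ} := (hclosed φ Fᶜ).isCompact
  have hn := hK.inter_iInter_nonempty (fun ψ : Γ => {e : ℕ → A | eval e ψ.1 ∈ F})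
    (fun ψ => hclosed _ _) (by
      intro u
      have hu := hne (Subtype.val '' (u : Set Γ)) (by rintro _ ⟨x, _, rfl⟩; exact x.2)
        (u.finite_toSet.image _)
      change ¬ ∀ e : ℕ → A, _ → _ at hu
      push Not at hu
      obtain ⟨e, he, hφ⟩ := hu
      refine ⟨e, hφ, ?_⟩
      simp only [Set.mem_iInter]
      exact fun ψ hψ => he _ ⟨ψ, hψ, rfl⟩)
  obtain ⟨e, heφ, he⟩ := hn
  simp only [Set.mem_iInter] at he
  exact heφ (h e fun ψ hψ => he ⟨ψ, hψ⟩)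

theorem finite_Grid {N : ℕ} (hN : 0 < N) : (Grid N).Finite := by
  refine ((Finset.range (N + 1)).finite_toSet.image fun a : ℕ => (a : ℚ) / N).subset ?_
  intro x hx
  obtain ⟨a, ha, rfl⟩ := (mem_Grid_iff hN).1 hx
  exact ⟨a, by simpa [Nat.lt_succ_iff] using ha, rfl⟩

theorem finite_LV {m : ℕ} (hm : 0 < m) : Finite (LV m) :=
  Set.Finite.to_subtype (s := Grid m) (finite_Grid hm)

theorem finitary_lukAt {m : ℕ} (hm : 0 < m) (c : ℚ) : (lukAt m c).Finitary :=
  have := finite_LV hm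
  finitary_matrixLogic _ _

theorem finitary_lukBarAt {m : ℕ} (hm : 0 < m) (c : ℚ) : (lukBarAt m c).Finitary :=
  have := finite_LV hm
  have := finite_LV one_pos
  finitary_matrixLogic _ _

theorem Logic.Finitary.inf {L₁ L₂ : Logic} (h₁ : L₁.Finitary) (h₂ : L₂.Finitary) :
    (L₁ ⊓ L₂).Finitary := by
  rintro Γ φ ⟨hd₁, hd₂⟩
  obtain ⟨Δ₁, hs₁, hf₁, hd₁⟩ := h₁ Γ φ hd₁
  obtain ⟨Δ₂, hs₂, hf₂, hd₂⟩ := h₂ Γ φ hd₂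
  exact ⟨Δ₁ ∪ Δ₂, Set.union_subset hs₁ hs₂, hf₁.union hf₂, hd₁.mono Set.subset_union_left,
    hd₂.mono Set.subset_union_right⟩

/-- A finitary logic that is not below `L` has a finitary rule that is not valid in `L`. -/
theorem Logic.Finitary.exists_rule {L L' : Logic} (h' : L'.Finitary) (h : ¬ L' ≤ L) :
    ∃ r : Rule, L'.Validates r ∧ ¬ L.Validates r := by
  by_contra hr
  push Not at hr
  refine h fun Γ φ hd => ?_
  obtain ⟨Δ, hs, hf, hd⟩ := h' Γ φ hd
  have := hr ⟨hf.toFinset.toList, φ⟩ (by simpa [Logic.Validates] using hd)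
  exact Logic.Deriv.mono (by simpa [Logic.Validates] using this) hs

/-! ### Definable functions of one variable -/

/-- The formula that results from `t` if all variables are replaced by `φ`. -/
def Fm.inst (t φ : Fm) : Fm := t.subst fun _ => φ

theorem eval_inst (e : ℕ → ℚ) (t φ : Fm) :
    eval e (t.inst φ) = eval (fun _ => eval e φ) t := eval_subst _ _ _

theorem subst_inst (σ : ℕ → Fm) (t φ : Fm) : (t.inst φ).subst σ = t.inst (φ.subst σ) :=
  Fm.subst_subst _ _ _

theorem vars_inst_subset (t φ : Fm) : (t.inst φ).vars ⊆ φ.vars := by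
  induction t with
  | var k => exact subset_rfl
  | neg t ih => exact ih
  | imp t s ih₁ ih₂ => exact Set.union_subset ih₁ ih₂

theorem eval_eq_of_vars_subset {t : Fm} (ht : t.vars ⊆ {0}) (e : ℕ → ℚ) :
    eval e t = eval (fun _ => e 0) t := by
  induction t with
  | var k =>
    have : k = 0 := by simpa [Fm.vars] using ht
    subst this
    rfl
  | neg t ih => simp only [eval_rat_neg]; rw [ih ht]
  | imp t s ih₁ ih₂ =>
    simp only [eval_rat_imp]
    rw [ih₁ (Set.subset_union_left.trans ht), ih₂ (Set.subset_union_right.trans ht)]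

theorem exists_separator_one {y : ℚ} (h0 : 0 ≤ y) (h1 : y < 1) :
    ∃ t : Fm, eval (fun _ => (1 : ℚ)) t = 1 ∧ eval (fun _ => y) t = 0 := by
  obtain ⟨l, hl⟩ := exists_nat_gt (1 / (1 - y))
  have hy : 0 < 1 - y := by linarith
  rw [div_lt_iff₀ hy] at hl
  refine ⟨Fm.neg (Fm.nmul l (Fm.neg (Fm.var 0))), ?_, ?_⟩
  · rw [eval_rat_neg, eval_nmul fun _ => ⟨zero_le_one, le_rfl⟩]
    simp
  · rw [eval_rat_neg, eval_nmul fun _ => ⟨h0, h1.le⟩]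
    simp only [eval_rat_neg, eval_rat_var]
    rw [min_eq_left hl.le, sub_self]

/-- If both points lie in the same half of the interval, z ⊕ z or its dual ¬(¬z ⊕ ¬z) doubles the
gap. If 1/2 separates them, z ⊕ z sends the larger to 1 and the smaller below 1, where
`exists_separator_one` applies. The exponent `k` bounds the number of doublings. -/
theorem exists_separator_of_gap (k : ℕ) {x y : ℚ} (h0 : 0 ≤ y) (hxy : y < x) (h1 : x ≤ 1)
    (hk : 1 ≤ 2 ^ k * (x - y)) :
    ∃ t : Fm, eval (fun _ => x) t = 1 ∧ eval (fun _ => y) t = 0 := by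
  induction k generalizing x y with
  | zero =>
    refine ⟨Fm.var 0, ?_, ?_⟩ <;> simp only [eval_rat_var] <;> linarith
  | succ k ih =>
    have hop : ∀ z : ℚ, z ≤ 1 / 2 →
        eval (fun _ => z) (Fm.oplus (Fm.var 0) (Fm.var 0)) = 2 * z := by
      intro z hz
      simp only [Fm.oplus, eval_rat_imp, eval_rat_neg, eval_rat_var]
      rw [min_eq_right (by linarith)]
      ring
    rcases le_or_gt x (1 / 2) with hx | hx
    · obtain ⟨t, ht₁, ht₂⟩ := ih (x := 2 * x) (y := 2 * y) (by linarith) (by linarith)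
        (by linarith) (by rw [pow_succ] at hk; linarith)
      refine ⟨t.inst (Fm.oplus (Fm.var 0) (Fm.var 0)), ?_, ?_⟩ <;>
        rw [eval_inst, hop _ (by linarith)]
      exacts [ht₁, ht₂]
    · rcases lt_or_ge y (1 / 2) with hy | hy
      · obtain ⟨t, ht₁, ht₂⟩ := exists_separator_one (y := 2 * y) (by linarith) (by linarith)
        refine ⟨t.inst (Fm.oplus (Fm.var 0) (Fm.var 0)), ?_, ?_⟩
        · rw [eval_inst, ← ht₁]
          congr 1
          funext _
          simp only [Fm.oplus, eval_rat_imp, eval_rat_neg, eval_rat_var]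
          exact min_eq_left (by linarith)
        · rw [eval_inst, hop _ hy.le, ht₂]
      · obtain ⟨t, ht₁, ht₂⟩ := ih (x := 2 * x - 1) (y := 2 * y - 1) (by linarith) (by linarith)
          (by linarith) (by rw [pow_succ] at hk; linarith)
        have hod : ∀ z : ℚ, 1 / 2 ≤ z → eval (fun _ => z)
            (Fm.neg (Fm.oplus (Fm.neg (Fm.var 0)) (Fm.neg (Fm.var 0)))) = 2 * z - 1 := by
          intro z hz
          simp only [Fm.oplus, eval_rat_imp, eval_rat_neg, eval_rat_var]
          rw [min_eq_right (by linarith)]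
          ring
        refine ⟨t.inst (Fm.neg (Fm.oplus (Fm.neg (Fm.var 0)) (Fm.neg (Fm.var 0)))), ?_, ?_⟩ <;>
          rw [eval_inst, hod _ (by linarith)]
        exacts [ht₁, ht₂]

theorem exists_separator {x y : ℚ} (hx : x ∈ Set.Icc (0 : ℚ) 1) (hy : y ∈ Set.Icc (0 : ℚ) 1)
    (hxy : x ≠ y) : ∃ t : Fm, eval (fun _ => x) t = 1 ∧ eval (fun _ => y) t = 0 := by
  have key : ∀ {x y : ℚ}, 0 ≤ y → y < x → x ≤ 1 →
      ∃ t : Fm, eval (fun _ => x) t = 1 ∧ eval (fun _ => y) t = 0 := by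
    intro x y h0 hxy h1
    have hpos : 0 < x - y := by linarith
    obtain ⟨k, hk⟩ := pow_unbounded_of_one_lt (1 / (x - y)) (one_lt_two (α := ℚ))
    rw [div_lt_iff₀ hpos] at hk
    exact exists_separator_of_gap k h0 hxy h1 hk.le
  rcases lt_or_gt_of_ne hxy with h | h
  · obtain ⟨t, ht₁, ht₂⟩ := key hx.1 h hy.2
    exact ⟨Fm.neg t, by simp [ht₂], by simp [ht₁]⟩
  · exact key hy.1 h hx.2

open Classical in
/-- Every subset of a finite chain has a characteristic function that is given by a formula. -/
theorem exists_char {N : ℕ} (hN : 0 < N) (S : Set ℚ) :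
    ∃ t : Fm, ∀ x ∈ Grid N, eval (fun _ => x) t = if x ∈ S then 1 else 0 := by
  have hI : ∀ x ∈ Grid N, ∀ k : ℕ, (fun _ : ℕ => x) k ∈ Set.Icc (0 : ℚ) 1 :=
    fun x hx _ => Grid_subset_Icc N hx
  -- A meet of separators isolates one point; joins of such formulas then give arbitrary sets.
  have hpt : ∀ x ∈ Grid N, ∀ T : Finset ℚ, (∀ y ∈ T, y ∈ Grid N ∧ y ≠ x) →
      ∃ t : Fm, eval (fun _ => x) t = 1 ∧ ∀ y ∈ T, eval (fun _ => y) t = 0 := by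
    intro x hx T
    induction T using Finset.induction_on with
    | empty => exact fun _ => ⟨Fm.imp (Fm.var 0) (Fm.var 0), by simp, by simp⟩
    | insert y T _ ih =>
      intro hT
      obtain ⟨t, ht₁, ht₂⟩ := ih fun z hz => hT z (Finset.mem_insert_of_mem hz)
      obtain ⟨hy, hyx⟩ := hT y (Finset.mem_insert_self _ _)
      obtain ⟨s, hs₁, hs₂⟩ := exists_separator (Grid_subset_Icc N hx) (Grid_subset_Icc N hy)
        hyx.symm
      refine ⟨Fm.meet t s, ?_, ?_⟩
      · rw [eval_meet (hI x hx), ht₁, hs₁, min_self]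
      · intro z hz
        have hzN := (hT z hz).1
        rw [eval_meet (hI z hzN)]
        rcases Finset.mem_insert.1 hz with rfl | hz
        · rw [hs₂]
          exact min_eq_right (eval_nonneg (hI z hzN))
        · rw [ht₂ z hz]
          exact min_eq_left (eval_nonneg (hI z hzN))
  let G : Finset ℚ := (Finset.range (N + 1)).image fun a : ℕ => (a : ℚ) / N
  have hG : ∀ x, x ∈ G ↔ x ∈ Grid N := by
    intro x
    rw [mem_Grid_iff hN]
    simp only [G, Finset.mem_image, Finset.mem_range, Nat.lt_succ_iff]
    exact exists_congr fun a => and_congr_right fun _ => eq_comm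
  have hsub : ∀ T : Finset ℚ, T ⊆ G →
      ∃ t : Fm, ∀ x ∈ Grid N, eval (fun _ => x) t = if x ∈ T then 1 else 0 := by
    intro T
    induction T using Finset.induction_on with
    | empty => exact fun _ => ⟨Fm.neg (Fm.imp (Fm.var 0) (Fm.var 0)), by simp⟩
    | insert y T _ ih =>
      intro hT
      rw [Finset.insert_subset_iff] at hT
      obtain ⟨t, ht⟩ := ih hT.2
      obtain ⟨s, hs₁, hs₂⟩ := hpt y ((hG y).1 hT.1) (G.erase y) fun z hz =>
        ⟨(hG z).1 (Finset.mem_of_mem_erase hz), Finset.ne_of_mem_erase hz⟩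
      refine ⟨Fm.join t s, fun x hx => ?_⟩
      rw [eval_join (hI x hx), ht x hx]
      rcases eq_or_ne x y with rfl | hxy
      · rw [hs₁, if_pos (Finset.mem_insert_self _ _)]
        exact max_eq_right (by split_ifs; norm_num)
      · rw [hs₂ x (Finset.mem_erase.2 ⟨hxy, (hG x).2 hx⟩)]
        simp only [Finset.mem_insert, hxy, false_or]
        exact max_eq_left (by split_ifs <;> norm_num)
  obtain ⟨t, ht⟩ := hsub (G.filter (· ∈ S)) (Finset.filter_subset _ _)
  refine ⟨t, fun x hx => ?_⟩
  rw [ht x hx]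
  simp [(hG x).2 hx]

/-- A formula in the variable `p₀` that defines the characteristic function of `S` on `Grid N`. -/
noncomputable def charFm {N : ℕ} (hN : 0 < N) (S : Set ℚ) : Fm :=
  (exists_char hN S).choose.inst (Fm.var 0)

open Classical in
theorem eval_charFm {N : ℕ} (hN : 0 < N) (S : Set ℚ) {e : ℕ → ℚ} (h : e 0 ∈ Grid N) :
    eval e (charFm hN S) = if e 0 ∈ S then 1 else 0 := by
  rw [charFm, eval_inst]
  exact (exists_char hN S).choose_spec _ h

open Classical in
theorem eval_charFm_inst {N : ℕ} (hN : 0 < N) (S : Set ℚ) {e : ℕ → ℚ} {φ : Fm}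
    (h : eval e φ ∈ Grid N) :
    eval e ((charFm hN S).inst φ) = if eval e φ ∈ S then 1 else 0 := by
  rw [eval_inst]
  exact eval_charFm hN S (e := fun _ => eval e φ) h

theorem vars_charFm {N : ℕ} (hN : 0 < N) (S : Set ℚ) : (charFm hN S).vars ⊆ {0} :=
  vars_inst_subset _ _

/-- The values of formulas under a fixed valuation in `Grid N` are generated by one of them. -/
theorem exists_generator {N : ℕ} (hN : 0 < N) {e : ℕ → ℚ} (he : ∀ k, e k ∈ Grid N) :
    ∃ M : ℕ, 0 < M ∧ M ∣ N ∧ (∃ t : Fm, eval e t = 1 / M) ∧ ∀ k, e k ∈ Grid M := by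
  classical
  have hN' : (0 : ℚ) < N := by exact_mod_cast hN
  have hI : ∀ k, e k ∈ Set.Icc (0 : ℚ) 1 := fun k => Grid_subset_Icc N (he k)
  have hex : ∃ g : ℕ, 0 < g ∧ ∃ t : Fm, eval e t = (g : ℚ) / N :=
    ⟨N, hN, Fm.imp (Fm.var 0) (Fm.var 0), by simp [hN'.ne']⟩
  -- The least positive numerator of a value. Truncated subtraction ¬(ψ → t) runs Euclidean division
  -- inside the set of values, so minimality makes `g` divide every numerator, including that of 1 =
  -- N/N; then M = N/g.
  set g := Nat.find hex with hg
  obtain ⟨hg0, t, ht⟩ := Nat.find_spec hex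
  rw [← hg] at hg0 ht
  have hsub : ∀ (φ : Fm) (l : ℕ), ∃ ψ : Fm, eval e ψ = max 0 (eval e φ - l * (g / N : ℚ)) := by
    intro φ l
    induction l with
    | zero => exact ⟨φ, by simp [eval_nonneg hI]⟩
    | succ l ih =>
      obtain ⟨ψ, hψ⟩ := ih
      refine ⟨Fm.neg (Fm.imp ψ t), ?_⟩
      simp only [eval_rat_neg, eval_rat_imp, hψ, ht]
      have hgn : (0 : ℚ) ≤ g / N := by positivity
      push_cast
      rcases le_total 0 (eval e φ - l * (g / N : ℚ)) with h | h
      · rw [max_eq_right h]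
        rcases le_total 0 (eval e φ - (l + 1) * (g / N : ℚ)) with h' | h'
        · rw [max_eq_right h', min_eq_right (by linarith)]; ring
        · rw [max_eq_left h', min_eq_left (by linarith)]; ring
      · rw [max_eq_left h, max_eq_left (by linarith), min_eq_left (by linarith)]; ring
  have hdvd : ∀ (φ : Fm) (b : ℕ), eval e φ = (b : ℚ) / N → g ∣ b := by
    intro φ b hb
    obtain ⟨ψ, hψ⟩ := hsub φ (b / g)
    have hmod : eval e ψ = ((b % g : ℕ) : ℚ) / N := by
      have h1 : (b : ℚ) = g * (b / g : ℕ) + (b % g : ℕ) := by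
        exact_mod_cast (Nat.div_add_mod b g).symm
      rw [hψ, hb, h1]
      have h2 : ((g * (b / g : ℕ) + (b % g : ℕ) : ℚ)) / N - (b / g : ℕ) * (g / N : ℚ) =
          ((b % g : ℕ) : ℚ) / N := by ring
      rw [h2]
      exact max_eq_right (by positivity)
    by_contra hnd
    exact Nat.find_min hex (m := b % g) (by rw [← hg]; exact Nat.mod_lt _ hg0)
      ⟨Nat.pos_of_ne_zero fun h => hnd (Nat.dvd_of_mod_eq_zero h), ψ, hmod⟩
  obtain ⟨M, hM⟩ := hdvd (Fm.imp (Fm.var 0) (Fm.var 0)) N (by simp [hN'.ne'])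
  have hM0 : 0 < M := Nat.pos_of_ne_zero (by rintro rfl; omega)
  have hg' : (0 : ℚ) < g := by exact_mod_cast hg0
  have hM' : (0 : ℚ) < M := by exact_mod_cast hM0
  have hNq : (N : ℚ) = g * M := by exact_mod_cast hM
  refine ⟨M, hM0, ⟨g, by rw [hM, mul_comm]⟩, ⟨t, by rw [ht, hNq]; field_simp⟩, fun k => ?_⟩
  obtain ⟨b, hb, hbe⟩ := (mem_Grid_iff hN).1 (he k)
  obtain ⟨b', rfl⟩ := hdvd (Fm.var k) b hbe
  refine (mem_Grid_iff hM0).2 ⟨b', Nat.le_of_mul_le_mul_left (hM ▸ hb) hg0, ?_⟩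
  rw [hbe, hNq]
  push_cast
  field_simp

/-! ### Extensions of the logic of a finite chain -/

/-- An extension of `lukAt N c` derives `φ` from `Γ` if it derives from `Γ` formulas that refute
all counterexamples in `Grid N`. -/
theorem deriv_of_refuting {N : ℕ} {c : ℚ} {L : Logic} (hL : lukAt N c ≤ L) {Γ : Set Fm} {φ : Fm}
    (h : ∀ e : ℕ → ℚ, (∀ k, e k ∈ Grid N) → (∀ ψ ∈ Γ, c ≤ eval e ψ) → ¬ c ≤ eval e φ →
      ∃ θ : Fm, L.Deriv Γ θ ∧ ¬ c ≤ eval e θ) : L.Deriv Γ φ := by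
  -- Cut through the whole `L`-theory of Γ, from which φ already follows in the base logic.
  refine L.cut' Γ {θ | L.Deriv Γ θ} φ (fun _ h => h) (hL _ _ (lukAt_deriv.2 fun e he hΔ => ?_))
  by_contra hφ
  obtain ⟨θ, hθ, hne⟩ := h e he (fun ψ hψ => hΔ ψ (L.refl' Γ ψ hψ)) hφ
  exact hne (hΔ θ hθ)

/-- Substitutions can send a point to any valuation in the subalgebra that it generates, and the
other points to any Boolean valuation. -/
theorem exists_subst {N M : ℕ} (hN : 0 < N) (hM : 0 < M) (t : Fm) {e₁ e₂ : ℕ → ℚ}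
    (h₁ : ∀ k, e₁ k ∈ Grid M) (h₂ : ∀ k, e₂ k ∈ Grid 1) :
    ∃ σ : ℕ → Fm, ∀ e : ℕ → ℚ, (∀ k, e k ∈ Grid N) →
      ∀ k, eval e (σ k) = if eval e t = 1 / M then e₁ k else e₂ k := by
  have hM' : (0 : ℚ) < M := by exact_mod_cast hM
  choose l hl using fun k => (mem_Grid_iff hM).1 (h₁ k)
  have hτ : ∀ k, ∃ ψ : Fm, ∀ e : ℕ → ℚ, (∀ k, e k ∈ Grid N) →
      eval e ψ = if eval e t = 1 / M then e₁ k else e₂ k := by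
    intro k
    have hval : ∀ e : ℕ → ℚ, (∀ k, e k ∈ Grid N) → eval e t = 1 / M →
        eval e (Fm.nmul (l k) t) = e₁ k := by
      intro e he ht
      rw [eval_nmul fun k => Grid_subset_Icc N (he k), ht, mul_one_div, ← (hl k).2]
      exact min_eq_right (h₁ k).2.1
    -- The multiple `l k` of `t` takes the value `e₁ k` where t = 1/M. Elsewhere, a meet with the
    -- indicator of 1/M forces 0, and a join with the indicator of its complement forces 1.
    rcases mem_Grid_one.1 (h₂ k) with h | h
    · refine ⟨Fm.meet (Fm.nmul (l k) t) ((charFm hN {1 / (M : ℚ)}).inst t), fun e he => ?_⟩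
      have hI : ∀ k, e k ∈ Set.Icc (0 : ℚ) 1 := fun k => Grid_subset_Icc N (he k)
      rw [eval_meet hI, eval_charFm_inst hN _ (eval_mem_Grid he t), Set.mem_singleton_iff]
      split_ifs with ht
      · rw [hval e he ht]
        exact min_eq_left (h₁ k).2.1
      · rw [h]
        exact min_eq_right (eval_nonneg hI)
    · refine ⟨Fm.join (Fm.nmul (l k) t) ((charFm hN {1 / (M : ℚ)}ᶜ).inst t), fun e he => ?_⟩
      have hI : ∀ k, e k ∈ Set.Icc (0 : ℚ) 1 := fun k => Grid_subset_Icc N (he k)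
      rw [eval_join hI, eval_charFm_inst hN _ (eval_mem_Grid he t), Set.mem_compl_iff,
        Set.mem_singleton_iff]
      by_cases ht : eval e t = 1 / M
      · rw [if_neg (not_not.2 ht), if_pos ht, hval e he ht]
        exact max_eq_left (h₁ k).1
      · rw [if_pos ht, if_neg ht, h]
        exact max_eq_right (eval_le_one hI)
  choose σ hσ using hτ
  exact ⟨σ, fun e he k => hσ k e he⟩

/-- If a rule is valid in an extension of `lukAt N c` and fails at `(e₁, e₂)` in the first
coordinate, then all points that generate a subalgebra containing `e₁` refute a theorem. -/
theorem exists_refuted_theorem {N M : ℕ} {c : ℚ} {L : Logic} (hN : 0 < N) (hM : 0 < M)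
    (hL : lukAt N c ≤ L) {Γ : Set Fm} {φ : Fm} (hr : L.Deriv Γ φ) {e₁ e₂ : ℕ → ℚ}
    (h₁ : ∀ k, e₁ k ∈ Grid M) (h₂ : ∀ k, e₂ k ∈ Grid 1)
    (hΓ : ∀ ψ ∈ Γ, c ≤ eval e₁ ψ ∧ c ≤ eval e₂ ψ) (hφ : ¬ c ≤ eval e₁ φ)
    {e : ℕ → ℚ} (he : ∀ k, e k ∈ Grid N) {t : Fm} (ht : eval e t = 1 / M) :
    ∃ θ : Fm, (∀ Δ, L.Deriv Δ θ) ∧ ¬ c ≤ eval e θ := by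
  obtain ⟨σ, hσ⟩ := exists_subst hN hM t h₁ h₂
  refine ⟨φ.subst σ, fun Δ => L.cut' Δ _ _ ?_ (L.structural' σ Γ φ hr), ?_⟩
  · rintro _ ⟨ψ, hψ, rfl⟩
    refine hL _ _ (lukAt_deriv.2 fun e' he' _ => ?_)
    rw [eval_subst]
    by_cases h : eval e' t = 1 / M
    · simp only [hσ e' he', h, if_true]
      exact (hΓ ψ hψ).1
    · simp only [hσ e' he', h, if_false]
      exact (hΓ ψ hψ).2
  · rw [eval_subst]
    simpa only [hσ e he, ht, if_true] using hφ

/-! ### A finite Hilbert calculus for a finite chain with an order filter -/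

section Calculus

/-- The implication between the formulas "`φ` is designated" and "`ψ` is designated", where the
formula `D` in one variable defines the designated elements. -/
def crispImp (D φ ψ : Fm) : Fm := Fm.imp (D.inst φ) (D.inst ψ)

theorem subst_crispImp (σ : ℕ → Fm) (D φ ψ : Fm) :
    (crispImp D φ ψ).subst σ = crispImp D (φ.subst σ) (ψ.subst σ) := by
  simp only [crispImp, Fm.subst, subst_inst]

/-- The substitution that replaces `p₀`, `p₁` and the other variables by the given formulas. -/
def threeSubst (φ ψ χ : Fm) : ℕ → Fm
  | 0 => φ
  | 1 => ψ
  | _ => χ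

/-- The axioms that say that `p₁` is designated if it follows from all the formulas `J a p₀`. -/
def exhaustion (D : Fm) (J : ℚ → Fm) (l : List ℚ) : Fm :=
  l.foldr (fun a χ => crispImp D (crispImp D ((J a).inst (Fm.var 0)) (Fm.var 1)) χ) (Fm.var 1)

/-- Modus ponens for `crispImp D`. -/
def modusPonens (D : Fm) : Rule := ⟨[Fm.var 0, crispImp D (Fm.var 0) (Fm.var 1)], Fm.var 1⟩

/-- The axioms of the calculus: the formula `D` defines the designated elements and `J a` the
element `a`. -/
def calculusAxioms (N : ℕ) (c : ℚ) (D : Fm) (J : ℚ → Fm) : Set Fm :=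
  {crispImp D (Fm.var 0) (crispImp D (Fm.var 1) (Fm.var 0)),
    crispImp D (crispImp D (Fm.var 0) (crispImp D (Fm.var 1) (Fm.var 2)))
      (crispImp D (crispImp D (Fm.var 0) (Fm.var 1)) (crispImp D (Fm.var 0) (Fm.var 2))),
    exhaustion D J ((List.range (N + 1)).map fun a : ℕ => (a : ℚ) / N)} ∪
  (fun a => crispImp D ((J a).inst (Fm.var 0)) ((J (Alg.neg a)).inst (Fm.neg (Fm.var 0)))) ''
    Grid N ∪
  Set.image2 (fun a b => crispImp D ((J a).inst (Fm.var 0)) (crispImp D ((J b).inst (Fm.var 1))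
    ((J (Alg.imp a b)).inst (Fm.imp (Fm.var 0) (Fm.var 1))))) (Grid N) (Grid N) ∪
  (fun a => crispImp D ((J a).inst (Fm.var 0)) (Fm.var 0)) '' {a ∈ Grid N | c ≤ a} ∪
  (fun a => crispImp D ((J a).inst (Fm.var 0)) (crispImp D (Fm.var 0) (Fm.var 1))) ''
    {a ∈ Grid N | ¬ c ≤ a}

/-- The rules of the calculus. -/
def calculus (N : ℕ) (c : ℚ) (D : Fm) (J : ℚ → Fm) : Set Rule :=
  insert (modusPonens D) (Rule.ax '' calculusAxioms N c D J)

theorem finite_calculus {N : ℕ} (hN : 0 < N) (c : ℚ) (D : Fm) (J : ℚ → Fm) :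
    (calculus N c D J).Finite := by
  have hG := finite_Grid hN
  refine Set.Finite.insert _ (Set.Finite.image _ ?_)
  exact ((((Set.toFinite _).union (hG.image _)).union (hG.image2 _ hG)).union
    ((hG.subset (Set.sep_subset _ _)).image _)).union ((hG.subset (Set.sep_subset _ _)).image _)

theorem HilbertDeriv.mono {H : Set Rule} {Γ Δ : Set Fm} {φ : Fm} (h : HilbertDeriv H Γ φ)
    (hs : Γ ⊆ Δ) : HilbertDeriv H Δ φ :=
  Logic.Deriv.mono (L := hilbertLogic H) h hs

theorem hilbertLogic_le {H : Set Rule} {L : Logic} (h : ∀ r ∈ H, L.Validates r) :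
    hilbertLogic H ≤ L := by
  intro Γ φ hd
  change HilbertDeriv H Γ φ at hd
  induction hd with
  | hyp φ hφ => exact L.refl' Γ φ hφ
  | rule r σ hr _ ih =>
    refine L.cut' Γ _ _ ?_ (L.structural' σ _ _ (h r hr))
    rintro _ ⟨ψ, hψ, rfl⟩
    exact ih ψ hψ

theorem hilbertLogic_validates {H : Set Rule} {r : Rule} (hr : r ∈ H) :
    (hilbertLogic H).Validates r := by
  have hid : ∀ φ : Fm, φ.subst Fm.var = φ := by
    intro φ
    induction φ with
    | var k => rfl
    | neg φ ih => rw [Fm.subst, ih]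
    | imp φ ψ ih₁ ih₂ => rw [Fm.subst, ih₁, ih₂]
  have h : HilbertDeriv H {φ | φ ∈ r.prems} (r.concl.subst Fm.var) :=
    HilbertDeriv.rule r Fm.var hr fun φ hφ => by
      rw [hid]
      exact HilbertDeriv.hyp φ hφ
  rwa [hid] at h

/-- Derivations use finitely many premises, so the union of a chain derives no more than its
members. -/
theorem HilbertDeriv.exists_of_sUnion {H : Set Rule} {C : Set (Set Fm)} (hC : IsChain (· ⊆ ·) C)
    (hne : C.Nonempty) {φ : Fm} (h : HilbertDeriv H (⋃₀ C) φ) : ∃ T ∈ C, HilbertDeriv H T φ := by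
  induction h with
  | hyp φ hφ =>
    obtain ⟨T, hT, hφ⟩ := hφ
    exact ⟨T, hT, HilbertDeriv.hyp φ hφ⟩
  | rule r σ hr _ ih =>
    have hl : ∀ l : List Fm, (∀ φ ∈ l, φ ∈ r.prems) →
        ∃ T ∈ C, ∀ φ ∈ l, HilbertDeriv H T (φ.subst σ) := by
      intro l
      induction l with
      | nil =>
        obtain ⟨T, hT⟩ := hne
        exact fun _ => ⟨T, hT, by simp⟩
      | cons ψ l ihl =>
        intro hψ
        obtain ⟨T, hT, hTl⟩ := ihl fun φ hφ => hψ φ (List.mem_cons_of_mem _ hφ)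
        obtain ⟨U, hU, hUψ⟩ := ih ψ (hψ ψ List.mem_cons_self)
        obtain ⟨V, hV, hTV, hUV⟩ : ∃ V ∈ C, T ⊆ V ∧ U ⊆ V :=
          (hC.total hT hU).elim (fun h => ⟨U, hU, h, subset_rfl⟩) fun h => ⟨T, hT, subset_rfl, h⟩
        refine ⟨V, hV, fun φ hφ => ?_⟩
        rcases List.mem_cons.1 hφ with rfl | hφ
        exacts [hUψ.mono hUV, (hTl φ hφ).mono hTV]
    obtain ⟨T, hT, hTl⟩ := hl r.prems fun _ h => h
    exact ⟨T, hT, HilbertDeriv.rule r σ hr hTl⟩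

variable {N : ℕ} {c : ℚ} {D : Fm} {J : ℚ → Fm} {Γ : Set Fm} {φ ψ χ : Fm}

local notation "⊢" => HilbertDeriv (calculus N c D J)

theorem calculus_ax (h : φ ∈ calculusAxioms N c D J) (σ : ℕ → Fm) : ⊢ Γ (φ.subst σ) :=
  HilbertDeriv.rule (Rule.ax φ) σ (Or.inr ⟨φ, h, rfl⟩) fun ψ hψ => by simp [Rule.ax] at hψ

theorem calculus_mp (h : ⊢ Γ φ) (h' : ⊢ Γ (crispImp D φ ψ)) : ⊢ Γ ψ := by
  refine HilbertDeriv.rule (modusPonens D) (threeSubst φ ψ ψ) (Or.inl rfl) fun χ hχ => ?_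
  simp only [modusPonens, List.mem_cons, List.not_mem_nil, or_false] at hχ
  rcases hχ with rfl | rfl
  · exact h
  · rw [subst_crispImp]
    exact h'

theorem calculus_K (φ ψ : Fm) : ⊢ Γ (crispImp D φ (crispImp D ψ φ)) := by
  have h := calculus_ax (Γ := Γ) (N := N) (c := c) (D := D) (J := J)
    (φ := crispImp D (Fm.var 0) (crispImp D (Fm.var 1) (Fm.var 0)))
    (by simp [calculusAxioms]) (threeSubst φ ψ ψ)
  simpa only [subst_crispImp, Fm.subst, threeSubst] using h

theorem calculus_S (φ ψ χ : Fm) : ⊢ Γ (crispImp D (crispImp D φ (crispImp D ψ χ))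
    (crispImp D (crispImp D φ ψ) (crispImp D φ χ))) := by
  have h := calculus_ax (Γ := Γ) (N := N) (c := c) (D := D) (J := J)
    (φ := crispImp D (crispImp D (Fm.var 0) (crispImp D (Fm.var 1) (Fm.var 2)))
      (crispImp D (crispImp D (Fm.var 0) (Fm.var 1)) (crispImp D (Fm.var 0) (Fm.var 2))))
    (by simp [calculusAxioms]) (threeSubst φ ψ χ)
  simpa only [subst_crispImp, Fm.subst, threeSubst] using h

/-- Modus ponens for `crispImp D` is the only rule with premises, so the axioms K and S suffice as
in classical logic. -/
theorem calculus_deduction (h : ⊢ (insert φ Γ) ψ) : ⊢ Γ (crispImp D φ ψ) := by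
  induction h with
  | hyp ψ hψ =>
    rcases hψ with rfl | hψ
    · exact calculus_mp (calculus_K ψ ψ) (calculus_mp (calculus_K ψ (crispImp D ψ ψ))
        (calculus_S ψ (crispImp D ψ ψ) ψ))
    · exact calculus_mp (HilbertDeriv.hyp ψ hψ) (calculus_K ψ φ)
  | rule r σ hr hp ih =>
    rcases hr with rfl | ⟨ψ, hψ, rfl⟩
    · have h₁ := ih (Fm.var 0) (by simp [modusPonens])
      have h₂ := ih (crispImp D (Fm.var 0) (Fm.var 1)) (by simp [modusPonens])
      rw [subst_crispImp] at h₂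
      exact calculus_mp h₁ (calculus_mp h₂ (calculus_S _ _ _))
    · exact calculus_mp (calculus_ax hψ σ) (calculus_K _ φ)

theorem calculus_exhaustion (l : List ℚ) (h : ⊢ Γ ((exhaustion D J l).subst (threeSubst φ ψ ψ)))
    (hl : ∀ a ∈ l, ⊢ Γ (crispImp D ((J a).inst φ) ψ)) : ⊢ Γ ψ := by
  induction l with
  | nil => exact h
  | cons a l ih =>
    refine ih ?_ fun b hb => hl b (List.mem_cons_of_mem _ hb)
    rw [exhaustion, List.foldr_cons, subst_crispImp, subst_crispImp, subst_inst] at h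
    exact calculus_mp (hl a List.mem_cons_self) h

/-- Extend Γ to a set `T` maximal among those not deriving φ. By the exhaustion axiom, `T` assigns
each variable a truth value through `J`; the axioms for the connectives propagate this to all
formulas, and the last two groups of axioms tie values to designation. No property of `D` and `J` is
needed here, only for soundness. -/
theorem calculus_complete (hN : 0 < N) : lukAt N c ≤ hilbertLogic (calculus N c D J) := by
  intro Γ φ hd
  change ⊢ Γ φ
  by_contra hΓ
  obtain ⟨T, hΓT, hT⟩ := zorn_subset_nonempty {T : Set Fm | ¬ ⊢ T φ} (fun C hC hchain hne =>
    ⟨⋃₀ C, fun h => by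
      obtain ⟨T, hTC, hT⟩ := h.exists_of_sUnion hchain hne
      exact hC hTC hT, fun T hT => Set.subset_sUnion_of_mem hT⟩) Γ hΓ
  have hTφ : ¬ ⊢ T φ := hT.prop
  have hnot : ∀ ψ, ψ ∉ T → ⊢ T (crispImp D ψ φ) := by
    intro ψ hψ
    by_contra h
    exact hψ (hT.le_of_ge (y := insert ψ T) (fun h' => h (calculus_deduction h'))
      (Set.subset_insert ψ T) (Set.mem_insert ψ T))
  have hex : ∀ ψ, ∃ a ∈ Grid N, ⊢ T ((J a).inst ψ) := by
    intro ψ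
    by_contra hne
    push Not at hne
    refine hTφ (calculus_exhaustion (φ := ψ) ((List.range (N + 1)).map fun a : ℕ => (a : ℚ) / N)
      (calculus_ax (by simp [calculusAxioms]) _) fun a ha => hnot _ fun h => hne a ?_
        (HilbertDeriv.hyp _ h))
    simp only [List.mem_map, List.mem_range, Nat.lt_succ_iff] at ha
    obtain ⟨b, hb, rfl⟩ := ha
    exact (mem_Grid_iff hN).2 ⟨b, hb, rfl⟩
  choose e he hJ using fun k => hex (Fm.var k)
  have hval : ∀ ψ, ⊢ T ((J (eval e ψ)).inst ψ) := by
    intro ψ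
    induction ψ with
    | var k => exact hJ k
    | neg ψ ih =>
      have h := calculus_ax (Γ := T) (N := N) (c := c) (D := D) (J := J)
        (Or.inl (Or.inl (Or.inl (Or.inr ⟨eval e ψ, eval_mem_Grid he ψ, rfl⟩))))
        (threeSubst ψ ψ ψ)
      simp only [subst_crispImp, subst_inst, Fm.subst, threeSubst] at h
      exact calculus_mp ih h
    | imp ψ χ ih₁ ih₂ =>
      have h := calculus_ax (Γ := T) (N := N) (c := c) (D := D) (J := J)
        (Or.inl (Or.inl (Or.inr ⟨eval e ψ, eval_mem_Grid he ψ, eval e χ, eval_mem_Grid he χ, rfl⟩)))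
        (threeSubst ψ χ χ)
      simp only [subst_crispImp, subst_inst, Fm.subst, threeSubst] at h
      exact calculus_mp ih₂ (calculus_mp ih₁ h)
  have hdes : ∀ ψ ∈ Γ, c ≤ eval e ψ := by
    intro ψ hψ
    by_contra hne
    have h := calculus_ax (Γ := T) (N := N) (c := c) (D := D) (J := J)
      (Or.inr ⟨eval e ψ, ⟨eval_mem_Grid he ψ, hne⟩, rfl⟩) (threeSubst ψ φ φ)
    simp only [subst_crispImp, subst_inst, Fm.subst, threeSubst] at h
    exact hTφ (calculus_mp (HilbertDeriv.hyp ψ (hΓT hψ)) (calculus_mp (hval ψ) h))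
  have h := calculus_ax (Γ := T) (N := N) (c := c) (D := D) (J := J)
    (Or.inl (Or.inr ⟨eval e φ, ⟨eval_mem_Grid he φ, lukAt_deriv.1 hd e he hdes⟩, rfl⟩))
    (threeSubst φ φ φ)
  simp only [subst_crispImp, subst_inst, Fm.subst, threeSubst] at h
  exact hTφ (calculus_mp (hval φ) h)

theorem calculus_sound (hN : 0 < N) (hc0 : 0 < c) (hc1 : c ≤ 1) :
    hilbertLogic (calculus N c (charFm hN {x | c ≤ x}) fun a => charFm hN {a}) ≤ lukAt N c := by
  classical
  -- Characteristic formulas take only the values 0 and 1, and 0 < c ≤ 1 designates 1 but not 0, so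
  -- `crispImp` is classical implication between designations.
  have himp : ∀ {e : ℕ → ℚ}, (∀ k, e k ∈ Grid N) → ∀ φ ψ : Fm,
      c ≤ eval e (crispImp (charFm hN {x | c ≤ x}) φ ψ) ↔ (c ≤ eval e φ → c ≤ eval e ψ) := by
    intro e he φ ψ
    rw [crispImp, eval_rat_imp, eval_charFm_inst hN _ (eval_mem_Grid he φ),
      eval_charFm_inst hN _ (eval_mem_Grid he ψ)]
    by_cases h₁ : c ≤ eval e φ <;> by_cases h₂ : c ≤ eval e ψ <;> simp [h₁, h₂, hc0, hc1]
  have hJ : ∀ {e : ℕ → ℚ}, (∀ k, e k ∈ Grid N) → ∀ (a : ℚ) (φ : Fm),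
      c ≤ eval e ((charFm hN {a}).inst φ) ↔ eval e φ = a := by
    intro e he a φ
    rw [eval_charFm_inst hN _ (eval_mem_Grid he φ), Set.mem_singleton_iff]
    by_cases h : eval e φ = a <;> simp [h, hc0, hc1]
  refine hilbertLogic_le ?_
  rintro r (rfl | ⟨φ, hφ, rfl⟩)
  · refine lukAt_deriv.2 fun e he h => ?_
    exact (himp he _ _).1 (h (crispImp _ (Fm.var 0) (Fm.var 1)) (by simp [modusPonens]))
      (h (Fm.var 0) (by simp [modusPonens]))
  · refine lukAt_deriv.2 fun e he _ => ?_
    change c ≤ eval e φ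
    rcases hφ with (((hφ | ⟨a, _, rfl⟩) | ⟨a, _, b, _, rfl⟩) | ⟨a, ha, rfl⟩) | ⟨a, ha, rfl⟩
    · rcases hφ with rfl | rfl | rfl
      · simp only [himp he]
        tauto
      · simp only [himp he]
        tauto
      · have hexh : ∀ l : List ℚ, (c ≤ eval e (exhaustion (charFm hN {x | c ≤ x})
            (fun a => charFm hN {a}) l) ↔ ((∀ a ∈ l, e 0 = a → c ≤ e 1) → c ≤ e 1)) := by
          intro l
          induction l with
          | nil => simp [exhaustion]
          | cons a l ih =>
            rw [exhaustion, List.foldr_cons, himp he, himp he, hJ he, ← exhaustion, ih]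
            simp only [List.mem_cons, forall_eq_or_imp, eval_rat_var]
            tauto
        rw [hexh]
        intro h
        obtain ⟨a, ha, hea⟩ := (mem_Grid_iff hN).1 (he 0)
        refine h (e 0) ?_ rfl
        rw [hea]
        exact List.mem_map.2 ⟨a, List.mem_range.2 (Nat.lt_succ_iff.2 ha), rfl⟩
    · simp only [himp he, hJ he]
      rintro rfl
      rfl
    · simp only [himp he, hJ he]
      rintro rfl rfl
      rfl
    · simp only [himp he, hJ he]
      rintro rfl
      exact ha.2
    · simp only [himp he, hJ he]
      rintro rfl h
      exact absurd h ha.2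

end Calculus

theorem exists_finite_calculus {N : ℕ} {c : ℚ} (hN : 0 < N) (hc0 : 0 < c) (hc1 : c ≤ 1) :
    ∃ H : Set Rule, H.Finite ∧ hilbertLogic H = lukAt N c :=
  ⟨_, finite_calculus hN c _ _,
    le_antisymm (calculus_sound hN hc0 hc1) (calculus_complete hN)⟩

/-- Adding rules to a Hilbert calculus adjoins them to its logic. -/
theorem hilbertLogic_union (H R : Set Rule) :
    hilbertLogic (H ∪ R) = (hilbertLogic H).adjoin R := by
  refine le_antisymm (hilbertLogic_le ?_) ?_
  · rintro r (hr | hr) L hL hR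
    · exact hL _ _ (hilbertLogic_validates hr)
    · exact hR r hr
  · intro Γ φ h
    exact h _ (hilbertLogic_le fun r hr => hilbertLogic_validates (Or.inl hr))
      fun r hr => hilbertLogic_validates (Or.inr hr)

/-! ### Relative axiomatizations -/

theorem Logic.validates_ax {L : Logic} {φ : Fm} : L.Validates (Rule.ax φ) ↔ L.Deriv ∅ φ := by
  simp [Logic.Validates, Rule.ax]

theorem Logic.Validates.deriv_subst {L : Logic} {φ : Fm} (h : L.Validates (Rule.ax φ))
    (σ : ℕ → Fm) (Γ : Set Fm) : L.Deriv Γ (φ.subst σ) :=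
  Logic.Deriv.mono (by simpa using L.structural' σ ∅ φ (Logic.validates_ax.1 h))
    (Set.empty_subset Γ)

theorem Logic.le_adjoin (L : Logic) (R : Set Rule) : L ≤ L.adjoin R :=
  fun Γ φ h _ hL _ => hL Γ φ h

theorem Logic.adjoin_validates (L : Logic) {R : Set Rule} {r : Rule} (hr : r ∈ R) :
    (L.adjoin R).Validates r := fun _ _ hR => hR r hr

theorem Logic.adjoin_le {L L' : Logic} {R : Set Rule} (h : L ≤ L')
    (hR : ∀ r ∈ R, L'.Validates r) : L.adjoin R ≤ L' := fun _ _ hd => hd L' h hR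

theorem Logic.Validates.mono {L L' : Logic} (h : L ≤ L') {r : Rule} (hr : L.Validates r) :
    L'.Validates r := h _ _ hr

theorem lukAt_validates_charFm {N d : ℕ} (hN : 0 < N) (hd : d ∣ N) {c : ℚ} (hc1 : c ≤ 1)
    {S : Set ℚ} (hS : Grid d ⊆ S) : (lukAt d c).Validates (Rule.ax (charFm hN S)) := by
  rw [Logic.validates_ax, lukAt_deriv]
  intro e he _
  rw [eval_charFm hN S (Grid_mono hd (he 0)), if_pos (hS (he 0))]
  exact hc1

theorem not_lukAt_validates_charFm {N d : ℕ} (hN : 0 < N) (hd : d ∣ N) {c : ℚ} (hc0 : 0 < c)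
    {S : Set ℚ} (hS : ¬ Grid d ⊆ S) : ¬ (lukAt d c).Validates (Rule.ax (charFm hN S)) := by
  obtain ⟨x, hx, hxS⟩ := Set.not_subset.1 hS
  rw [Logic.validates_ax, lukAt_deriv]
  intro h
  have := h (fun _ => x) (fun _ => hx) (by simp)
  rw [eval_charFm hN S (Grid_mono hd hx), if_neg hxS] at this
  exact this.not_gt hc0

/-- Counterexamples that generate a subalgebra not included in `S` are refuted by `charFm S`. -/
theorem exists_refuted_charFm {N M : ℕ} (hN : 0 < N) {c : ℚ} (hc0 : 0 < c) {S : Set ℚ}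
    {L : Logic} (hL : L.Validates (Rule.ax (charFm hN S))) {e : ℕ → ℚ}
    (he : ∀ k, e k ∈ Grid N) {t : Fm} (ht : eval e t = 1 / M) (hS : 1 / (M : ℚ) ∉ S)
    (Γ : Set Fm) : ∃ θ : Fm, L.Deriv Γ θ ∧ ¬ c ≤ eval e θ := by
  refine ⟨(charFm hN S).inst t, hL.deriv_subst _ Γ, ?_⟩
  rw [eval_charFm_inst hN S (eval_mem_Grid he t), ht, if_neg hS]
  exact hc0.not_ge

theorem not_generator_dvd {c : ℚ} {d M : ℕ} {Γ : Set Fm} {φ : Fm}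
    (h : (lukAt d c).Deriv Γ φ) {e : ℕ → ℚ} (heM : ∀ k, e k ∈ Grid M)
    (hΓ : ∀ ψ ∈ Γ, c ≤ eval e ψ) (hφ : ¬ c ≤ eval e φ) : ¬ M ∣ d :=
  fun hd => hφ (lukAt_deriv.1 h e (fun k => Grid_mono hd (heM k)) hΓ)

/-- A counterexample generates some `Grid M` with M ∤ n, so its value 1/M lies outside `Grid n` and
falsifies an instance of the axiom. -/
theorem isAxiomFor_charFm_Grid {N n : ℕ} (hN : 0 < N) (hn : n ∣ N) {c : ℚ} (hc0 : 0 < c)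
    (hc1 : c ≤ 1) : IsAxiomFor (lukAt N c) (lukAt n c) (charFm hN (Grid n)) := by
  refine ⟨vars_charFm hN _, le_antisymm (Logic.adjoin_le (lukAt_le_lukAt hn c) ?_) ?_⟩
  · rintro r rfl
    exact lukAt_validates_charFm hN hn hc1 subset_rfl
  · intro Γ φ hd
    refine deriv_of_refuting (Logic.le_adjoin _ _) fun e he hΓ hφ => ?_
    obtain ⟨M, hM, _, ⟨t, ht⟩, heM⟩ := exists_generator hN he
    exact exists_refuted_charFm hN hc0 (Logic.adjoin_validates _ (Set.mem_singleton _)) he ht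
      (fun h => not_generator_dvd hd heM hΓ hφ ((inv_mem_Grid_iff hM).1 h)) Γ

theorem isAxiomFor_charFm_union {N n m : ℕ} (hN : 0 < N) (hn : n ∣ N) (hm : m ∣ N) {c : ℚ}
    (hc0 : 0 < c) (hc1 : c ≤ 1) :
    IsAxiomFor (lukAt N c) (lukAt n c ⊓ lukAt m c) (charFm hN (Grid n ∪ Grid m)) := by
  refine ⟨vars_charFm hN _, le_antisymm (Logic.adjoin_le
    (fun Γ φ h => ⟨lukAt_le_lukAt hn c Γ φ h, lukAt_le_lukAt hm c Γ φ h⟩) ?_) ?_⟩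
  · rintro r rfl
    exact ⟨lukAt_validates_charFm hN hn hc1 Set.subset_union_left,
      lukAt_validates_charFm hN hm hc1 Set.subset_union_right⟩
  · intro Γ φ hd
    refine deriv_of_refuting (Logic.le_adjoin _ _) fun e he hΓ hφ => ?_
    obtain ⟨M, hM, _, ⟨t, ht⟩, heM⟩ := exists_generator hN he
    refine exists_refuted_charFm hN hc0 (Logic.adjoin_validates _ (Set.mem_singleton _)) he ht ?_ Γ
    rintro (h | h)
    · exact not_generator_dvd hd.1 heM hΓ hφ ((inv_mem_Grid_iff hM).1 h)
    · exact not_generator_dvd hd.2 heM hΓ hφ ((inv_mem_Grid_iff hM).1 h)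

/-! ### Strong maximality -/

section Minimal

variable {N n m : ℕ} {c : ℚ}

theorem lukAt_le_inf (hn : n ∣ N) (hm : m ∣ N) (hc0 : 0 < c) (hc1 : c ≤ 1) :
    lukAt N c ≤ lukAt n c ⊓ lukBarAt m c :=
  fun Γ φ h => ⟨lukAt_le_lukAt hn c Γ φ h, lukAt_le_lukBarAt hm hc0 hc1 Γ φ h⟩

/-- Rules that are valid in an extension of the logic of a Boolean algebra can fail in `lukBarAt`
only in the first coordinate. -/
theorem exists_counterexample_lukBarAt {L : Logic} (hL : L ≤ lukAt 1 c) (hc0 : 0 < c)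
    (hc1 : c ≤ 1) {Γ : Set Fm} {φ : Fm} (hd : L.Deriv Γ φ) (h : ¬ (lukBarAt m c).Deriv Γ φ) :
    ∃ e₁ e₂ : ℕ → ℚ, (∀ k, e₁ k ∈ Grid m) ∧ (∀ k, e₂ k ∈ Grid 1) ∧
      (∀ ψ ∈ Γ, c ≤ eval e₁ ψ ∧ c ≤ eval e₂ ψ) ∧ ¬ c ≤ eval e₁ φ := by
  rw [lukBarAt_deriv hc0 hc1] at h
  by_contra hne
  refine h fun e₁ e₂ h₁ h₂ hΓ => ⟨?_, lukAt_deriv.1 (hL _ _ hd) e₂ h₂ fun ψ hψ => (hΓ ψ hψ).2⟩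
  by_contra hφ
  exact hne ⟨e₁, e₂, h₁, h₂, hΓ, hφ⟩

/-- By `hdvd`, any counterexample to a rule of `lukAt n c` generates a chain containing `Grid m`. It
can therefore simulate the failure of the added rule in the bar matrix. -/
theorem stronglyMaximal_inf (hN : 0 < N) (hn : n ∣ N) (hm : m ∣ N) (hmn : ¬ m ∣ n)
    (hdvd : ∀ d, d ∣ N → d ∣ n ∨ m ∣ d) (hc0 : 0 < c) (hc1 : c ≤ 1) :
    (lukAt n c ⊓ lukBarAt m c).StronglyMaximal (lukAt n c) := by
  have hm0 : 0 < m := Nat.pos_of_dvd_of_pos hm hN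
  refine ⟨lt_iff_le_not_ge.2 ⟨fun Γ φ h => h.1, fun h => ?_⟩, fun r hr hnr => ?_⟩
  -- Properness: the indicator of `Grid n` is a theorem of `lukAt n c` that fails at 1/m.
  · have hb := (Logic.Validates.mono h
      (lukAt_validates_charFm hN hn hc1 (subset_refl (Grid n)))).2
    rw [lukBarAt_deriv hc0 hc1] at hb
    have := (hb (fun _ => 1 / (m : ℚ)) (fun _ => 0)
      (fun _ => (inv_mem_Grid_iff hm0).2 dvd_rfl) (fun _ => zero_mem_Grid 1)
      (by simp [Rule.ax])).1
    change c ≤ eval _ (charFm hN _) at this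
    rw [eval_charFm hN _ ((inv_mem_Grid_iff hm0).2 hm),
      if_neg fun h => hmn ((inv_mem_Grid_iff hm0).1 h)] at this
    exact this.not_gt hc0
  · refine le_antisymm (Logic.adjoin_le (fun Γ φ h => h.1) (by rintro _ rfl; exact hr)) ?_
    intro Γ φ hd
    have hL : lukAt N c ≤ (lukAt n c ⊓ lukBarAt m c).adjoin {r} :=
      (lukAt_le_inf hn hm hc0 hc1).trans (Logic.le_adjoin _ _)
    refine deriv_of_refuting hL fun e he hΓ hφ => ?_
    obtain ⟨M, hM, hMN, ⟨t, ht⟩, heM⟩ := exists_generator hN he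
    have hmM := (hdvd M hMN).resolve_left (not_generator_dvd hd heM hΓ hφ)
    obtain ⟨e₁, e₂, h₁, h₂, hr₁, hr₂⟩ := exists_counterexample_lukBarAt
      (lukAt_le_lukAt (one_dvd n) c) hc0 hc1 hr fun h => hnr ⟨hr, h⟩
    obtain ⟨θ, hθ, hne⟩ := exists_refuted_theorem hN hM hL
      (Logic.adjoin_validates _ (Set.mem_singleton r)) (fun k => Grid_mono hmM (h₁ k)) h₂ hr₁ hr₂
      he ht
    exact ⟨θ, hθ Γ, hne⟩

/-! ### Axiomatization by the explosion rule -/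

theorem exists_eval_congr (φ : Fm) :
    ∃ s : ℕ, ∀ e e' : ℕ → ℚ, (∀ k < s, e k = e' k) → eval e φ = eval e' φ := by
  induction φ with
  | var k => exact ⟨k + 1, fun e e' h => h k k.lt_succ_self⟩
  | neg φ ih =>
    obtain ⟨s, hs⟩ := ih
    exact ⟨s, fun e e' h => by rw [eval_rat_neg, eval_rat_neg, hs e e' h]⟩
  | imp φ ψ ih₁ ih₂ =>
    obtain ⟨s₁, hs₁⟩ := ih₁
    obtain ⟨s₂, hs₂⟩ := ih₂
    refine ⟨max s₁ s₂, fun e e' h => ?_⟩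
    rw [eval_rat_imp, eval_rat_imp, hs₁ e e' fun k hk => h k (lt_max_of_lt_left hk),
      hs₂ e e' fun k hk => h k (lt_max_of_lt_right hk)]

theorem exists_eval_congr_of_finite {Γ : Set Fm} (hΓ : Γ.Finite) :
    ∃ s : ℕ, ∀ φ ∈ Γ, ∀ e e' : ℕ → ℚ, (∀ k < s, e k = e' k) → eval e φ = eval e' φ := by
  choose s hs using exists_eval_congr
  obtain ⟨b, hb⟩ := (hΓ.image s).bddAbove
  exact ⟨b, fun φ hφ e e' h => hs φ e e' fun k hk =>
    h k (hk.trans_le (hb (Set.mem_image_of_mem s hφ)))⟩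

/-- The formula `⋁ k < s, p_k ∧ ¬ p_k`. -/
def nonBoolean : ℕ → Fm
  | 0 => Fm.neg (Fm.imp (Fm.var 0) (Fm.var 0))
  | s + 1 => Fm.join (nonBoolean s) (Fm.meet (Fm.var s) (Fm.neg (Fm.var s)))

theorem eval_nonBoolean_le {e : ℕ → ℚ} (he : ∀ k, e k ∈ Set.Icc (0 : ℚ) 1) (s : ℕ) :
    eval e (nonBoolean s) ≤ 1 / 2 := by
  induction s with
  | zero => simp [nonBoolean]
  | succ s ih =>
    rw [nonBoolean, eval_join he, eval_meet he, eval_rat_neg]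
    refine max_le ih ?_
    rcases le_total (eval e (Fm.var s)) (1 / 2) with h | h
    · exact (min_le_left _ _).trans h
    · exact (min_le_right _ _).trans (by linarith)

theorem eval_nonBoolean_pos {e : ℕ → ℚ} (he : ∀ k, e k ∈ Set.Icc (0 : ℚ) 1) {s k : ℕ}
    (hk : k < s) (hek : e k ∉ Grid 1) : 0 < eval e (nonBoolean s) := by
  induction s with
  | zero => omega
  | succ s ih =>
    rw [nonBoolean, eval_join he, eval_meet he, eval_rat_neg]
    rcases Nat.lt_succ_iff_lt_or_eq.1 hk with h | rfl
    · exact lt_max_of_lt_left (ih h)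
    · rw [mem_Grid_one, not_or] at hek
      refine lt_max_of_lt_right (lt_min ?_ (sub_pos.2 ?_))
      · exact lt_of_le_of_ne (he k).1 (Ne.symm hek.1)
      · exact lt_of_le_of_ne (he k).2 hek.2

/-- A non-Boolean variable makes `nonBoolean s` positive, hence at least 1/N. As its value is at
most 1/2, the meet with its negation does not change it, and `j` copies reach j/N. -/
theorem le_eval_explosion_premise (hN : 0 < N) {j : ℕ} (hj : j ≤ N) {e : ℕ → ℚ}
    (he : ∀ k, e k ∈ Grid N) {s k : ℕ} (hk : k < s) (hek : e k ∉ Grid 1) :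
    (j : ℚ) / N ≤ eval e (Fm.nmul j (Fm.meet (nonBoolean s) (Fm.neg (nonBoolean s)))) := by
  have hI : ∀ k, e k ∈ Set.Icc (0 : ℚ) 1 := fun k => Grid_subset_Icc N (he k)
  have hN' : (0 : ℚ) < N := by exact_mod_cast hN
  have hle := eval_nonBoolean_le hI s
  have hpos := eval_nonBoolean_pos hI hk hek
  rw [eval_nmul hI, eval_meet hI, eval_rat_neg, min_eq_left (b := 1 - _) (by linarith)]
  obtain ⟨a, -, hae⟩ := (mem_Grid_iff hN).1 (eval_mem_Grid he (nonBoolean s))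
  rw [hae] at hpos ⊢
  have ha : 0 < a := by
    rcases Nat.eq_zero_or_pos a with rfl | h
    · simp at hpos
    · exact h
  have ha' : (1 : ℚ) ≤ a := by exact_mod_cast ha
  refine le_min ((div_le_one hN').2 (by exact_mod_cast hj)) ?_
  rw [← mul_div_assoc]
  exact div_le_div_of_nonneg_right (le_mul_of_one_le_right (Nat.cast_nonneg j) ha') hN'.le

theorem not_le_eval_explosion_premise (hc0 : 0 < c) (j : ℕ) {e : ℕ → ℚ}
    (he : ∀ k, e k ∈ Grid 1) :
    ¬ c ≤ eval e (Fm.nmul j (Fm.meet (Fm.var 0) (Fm.neg (Fm.var 0)))) := by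
  have hI : ∀ k, e k ∈ Set.Icc (0 : ℚ) 1 := fun k => Grid_subset_Icc 1 (he k)
  rw [eval_nmul hI, eval_meet hI, eval_rat_neg, eval_rat_var]
  rcases mem_Grid_one.1 (he 0) with h | h <;> simpa [h] using hc0

/-- In the bar matrix the rule holds vacuously: the premise is 0 in the Boolean coordinate. -/
theorem inf_validates_explosionRule (hc0 : 0 < c) (hc1 : c ≤ 1) (j : ℕ) {γ : Fm}
    (hγ : (lukAt n c).Validates (Rule.ax γ)) :
    (lukAt n c ⊓ lukBarAt m c).Validates (explosionRule j γ) := by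
  refine ⟨hγ.deriv_subst _ _, (lukBarAt_deriv hc0 hc1).2 fun e₁ e₂ _ h₂ hp => ?_⟩
  exact absurd (hp _ (by simp [explosionRule])).2 (not_le_eval_explosion_premise hc0 j h₂)

theorem inf_validates_ax (hc0 : 0 < c) (hc1 : c ≤ 1) {γ : Fm}
    (h : (lukAt n c ⊓ lukAt m c).Validates (Rule.ax γ)) :
    (lukAt n c ⊓ lukBarAt m c).Validates (Rule.ax γ) := by
  refine ⟨h.1, (lukBarAt_deriv hc0 hc1).2 fun e₁ e₂ h₁ h₂ _ => ?_⟩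
  have hd := lukAt_deriv.1 (Logic.validates_ax.1 h.2)
  exact ⟨hd e₁ h₁ (by simp), hd e₂ (fun k => Grid_mono (one_dvd m) (h₂ k)) (by simp)⟩

/-- An axiom for the logic of a subchain fails at some point of every other chain. -/
theorem IsAxiomFor.exists_refuted {γ : Fm} (h : IsAxiomFor (lukAt N c) (lukAt n c) γ)
    (hN : 0 < N) (hn : n ∣ N) (hm : m ∣ N) (hmn : ¬ m ∣ n) (hc0 : 0 < c) (hc1 : c ≤ 1) :
    ∃ y ∈ Grid m, ¬ c ≤ eval (fun _ => y) γ := by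
  by_contra hne
  push Not at hne
  have hv : (lukAt m c).Validates (Rule.ax γ) := by
    rw [Logic.validates_ax, lukAt_deriv]
    intro e he _
    rw [eval_eq_of_vars_subset h.1]
    exact hne _ (he 0)
  have hle : lukAt n c ≤ lukAt m c := by
    rw [← h.2]
    exact Logic.adjoin_le (lukAt_le_lukAt hm c) (by rintro _ rfl; exact hv)
  have hm0 : 0 < m := Nat.pos_of_dvd_of_pos hm hN
  exact not_lukAt_validates_charFm hN hm hc0
    (fun hs => hmn ((inv_mem_Grid_iff hm0).1 (hs ((inv_mem_Grid_iff hm0).2 dvd_rfl))))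
    (Logic.Validates.mono hle (lukAt_validates_charFm hN hn hc1 subset_rfl))

/-- The axiom `γ'` refutes counterexamples with M ∤ n and M ∤ m. For M ∣ m, `hdvd` forces M = m, and
the explosion rule refutes them. Finitarity bounds the variables of the premises, so that
`nonBoolean s` can speak about all of them. -/
theorem adjoin_explosionRule (hN : 0 < N) (hn : n ∣ N) (hm : m ∣ N) (hmn : ¬ m ∣ n)
    (hdvd : ∀ d, d ∣ N → d ∣ n ∨ m ∣ d) {j : ℕ} (hj0 : 0 < j) (hj : j ≤ N) {γ' γ : Fm}
    (hγ' : IsAxiomFor (lukAt N ((j : ℚ) / N)) (lukAt n ((j : ℚ) / N) ⊓ lukAt m ((j : ℚ) / N)) γ')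
    (hγ : IsAxiomFor (lukAt N ((j : ℚ) / N)) (lukAt n ((j : ℚ) / N)) γ) :
    (lukAt N ((j : ℚ) / N)).adjoin {Rule.ax γ', explosionRule j γ} =
      lukAt n ((j : ℚ) / N) ⊓ lukBarAt m ((j : ℚ) / N) := by
  have hN' : (0 : ℚ) < N := by exact_mod_cast hN
  have hc0 : 0 < (j : ℚ) / N := div_pos (by exact_mod_cast hj0) hN'
  have hc1 : (j : ℚ) / N ≤ 1 := (div_le_one hN').2 (by exact_mod_cast hj)
  have hm0 : 0 < m := Nat.pos_of_dvd_of_pos hm hN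
  have hn0 : 0 < n := Nat.pos_of_dvd_of_pos hn hN
  obtain ⟨y, hy, hγy⟩ := hγ.exists_refuted hN hn hm hmn hc0 hc1
  refine le_antisymm (Logic.adjoin_le (lukAt_le_inf hn hm hc0 hc1) ?_) ?_
  · rintro r (rfl | rfl)
    · exact inf_validates_ax hc0 hc1 (by rw [← hγ'.2]; exact Logic.adjoin_validates _ rfl)
    · exact inf_validates_explosionRule hc0 hc1 j
        (by rw [← hγ.2]; exact Logic.adjoin_validates _ rfl)
  · intro Γ φ hd
    obtain ⟨Δ, hΔ, hΔf, hd⟩ := ((finitary_lukAt hn0 _).inf (finitary_lukBarAt hm0 _)) Γ φ hd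
    refine Logic.Deriv.mono (deriv_of_refuting (Logic.le_adjoin _ _) fun e he hΔe hφ => ?_) hΔ
    set L := (lukAt N ((j : ℚ) / N)).adjoin {Rule.ax γ', explosionRule j γ} with hL
    have hBL : lukAt N ((j : ℚ) / N) ≤ L := Logic.le_adjoin _ _
    obtain ⟨M, hM, hMN, ⟨t, ht⟩, heM⟩ := exists_generator hN he
    have hMn := not_generator_dvd hd.1 heM hΔe hφ
    by_cases hMm : M ∣ m
    · obtain rfl : m = M := Nat.dvd_antisymm ((hdvd M hMN).resolve_left hMn) hMm
      obtain ⟨s, hs⟩ := exists_eval_congr_of_finite hΔf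
      have hprem : L.Deriv Δ
          (Fm.nmul j (Fm.meet (nonBoolean s) (Fm.neg (nonBoolean s)))) := by
        refine hBL _ _ (lukAt_deriv.2 fun e' he' hΔe' => ?_)
        by_cases hk : ∃ k < s, e' k ∉ Grid 1
        · obtain ⟨k, hk, hek⟩ := hk
          exact le_eval_explosion_premise hN hj he' hk hek
        -- A model of Δ that is Boolean on the first `s` variables, paired with `e`, would violate
        -- the rule in the bar matrix. The later variables do not matter for Δ and are set to 0.
        · push Not at hk
          refine absurd ((lukBarAt_deriv hc0 hc1).1 hd.2 e (fun k => if k < s then e' k else 0) heM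
            (fun k => ?_) fun ψ hψ => ⟨hΔe ψ hψ, ?_⟩).1 hφ
          · split_ifs with h
            exacts [hk k h, zero_mem_Grid 1]
          · rw [hs ψ hψ _ e' fun k hk => if_pos hk]
            exact hΔe' ψ hψ
      -- The point `y` where γ fails is a multiple of 1/m, the value of `t` at `e`.
      obtain ⟨l, -, hl⟩ := (mem_Grid_iff hm0).1 hy
      have hψ : eval e (Fm.nmul l t) = y := by
        rw [eval_nmul fun k => Grid_subset_Icc N (he k), ht, mul_one_div, ← hl]
        exact min_eq_right hy.2.1
      have hrule := L.structural' (threeSubst (nonBoolean s) (Fm.nmul l t) (Fm.nmul l t)) _ _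
        (Logic.adjoin_validates _ (Or.inr rfl) : L.Validates (explosionRule j γ))
      refine ⟨_, L.cut' Δ _ _ ?_ hrule, ?_⟩
      · rintro _ ⟨ψ, hψ, rfl⟩
        have hnmul : ∀ (σ : ℕ → Fm) (χ : Fm) (i : ℕ), (Fm.nmul i χ).subst σ =
            Fm.nmul i (χ.subst σ) := by
          intro σ χ i
          induction i with
          | zero => rfl
          | succ i ih =>
            cases i with
            | zero => rfl
            | succ i => simp only [Fm.nmul, Fm.oplus, Fm.subst, ih]
        obtain rfl : ψ = _ := List.mem_singleton.1 hψ
        rw [hnmul]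
        exact hprem
      · rw [explosionRule, Fm.subst_subst, eval_subst]
        simpa only [Fm.subst, threeSubst, hψ] using hγy
    · have hv : L.Validates (Rule.ax (charFm hN (Grid n ∪ Grid m))) := by
        have hle : lukAt n ((j : ℚ) / N) ⊓ lukAt m ((j : ℚ) / N) ≤ L := by
          rw [← hγ'.2]
          exact Logic.adjoin_le hBL
            (by rintro _ rfl; exact Logic.adjoin_validates _ (Or.inl rfl))
        exact Logic.Validates.mono hle
          ⟨lukAt_validates_charFm hN hn hc1 Set.subset_union_left,
            lukAt_validates_charFm hN hm hc1 Set.subset_union_right⟩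
      refine exists_refuted_charFm hN hc0 hv he ht ?_ Δ
      rintro (h | h)
      exacts [hMn ((inv_mem_Grid_iff hM).1 h), hMm ((inv_mem_Grid_iff hM).1 h)]

end Minimal

/-! ### Prime powers -/

section PrimePower

variable {n q r i j : ℕ}

theorem prime_pow_dvd_mul (hr : q ^ r ∣ n) : q ^ (r + 1) ∣ n * q :=
  pow_succ q r ▸ Nat.mul_dvd_mul_right hr q

/-- Write d = q^a d' with q ∤ d'. Then d' divides n, and only the comparison of a with r matters. -/
theorem dvd_or_prime_pow_dvd (hq : q.Prime) (hn : 0 < n) (hr : q ^ r ∣ n) {d : ℕ}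
    (hd : d ∣ n * q) : d ∣ n ∨ q ^ (r + 1) ∣ d := by
  have hd0 : d ≠ 0 := (Nat.pos_of_dvd_of_pos hd (Nat.mul_pos hn hq.pos)).ne'
  obtain ⟨a, d', hd', rfl⟩ := Nat.exists_eq_pow_mul_and_not_dvd hd0 q hq.ne_one
  have hcop : Nat.Coprime q d' := (Nat.Prime.coprime_iff_not_dvd hq).2 hd'
  rcases Nat.lt_or_ge r a with h | h
  · exact Or.inr ((pow_dvd_pow q h).trans (Nat.dvd_mul_right _ _))
  · exact Or.inl ((hcop.pow_left a).mul_dvd_of_dvd_of_dvd ((pow_dvd_pow q h).trans hr)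
      (hcop.symm.dvd_of_dvd_mul_right ((Nat.dvd_mul_left _ _).trans hd)))

theorem mul_prime_dvd (hq : q.Prime) (hr : q ^ r ∣ n) (hr' : ¬ q ^ (r + 1) ∣ n) {k : ℕ}
    (hn : n ∣ k) (hk : q ^ (r + 1) ∣ k) : n * q ∣ k := by
  obtain ⟨n', rfl⟩ := hr
  have hcop : Nat.Coprime q n' := (Nat.Prime.coprime_iff_not_dvd hq).2 fun h =>
    hr' (pow_succ q r ▸ Nat.mul_dvd_mul_left _ h)
  have : q ^ r * n' * q = q ^ (r + 1) * n' := by ring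
  rw [this]
  exact (hcop.pow_left _).mul_dvd_of_dvd_of_dvd hk ((Nat.dvd_mul_left _ _).trans hn)

theorem exists_prime_pow_dvd_of_not_dvd {M : ℕ} (h : ¬ M ∣ n) :
    ∃ q r : ℕ, q.Prime ∧ q ^ r ∣ n ∧ ¬ q ^ (r + 1) ∣ n ∧ q ^ (r + 1) ∣ M := by
  rw [Nat.dvd_iff_prime_pow_dvd_dvd] at h
  push Not at h
  obtain ⟨q, k, hq, hkM, hkn⟩ := h
  have hex : ∃ k, ¬ q ^ k ∣ n := ⟨k, hkn⟩
  obtain ⟨r, hr⟩ : ∃ r, Nat.find hex = r + 1 := Nat.exists_eq_succ_of_ne_zero fun h0 => by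
    have := Nat.find_spec hex
    rw [h0] at this
    simp at this
  refine ⟨q, r, hq, ?_, hr ▸ Nat.find_spec hex,
    (pow_dvd_pow q (hr ▸ Nat.find_min' hex hkn)).trans hkM⟩
  by_contra hnd
  have := Nat.find_min' hex hnd
  omega

/-- The bounds on `j` say that j/(nq) lies in ((i-1)/n, i/n], so both thresholds cut `Grid n` at the
same place. -/
theorem luk_eq_lukAt (hi : 0 < i) (hn : 0 < n) (hq : 0 < q) (hj : (i - 1) * q < j)
    (hj' : j ≤ i * q) : luk n i = lukAt n ((j : ℚ) / ((n * q : ℕ) : ℚ)) := by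
  have hn' : (0 : ℚ) < n := by exact_mod_cast hn
  have hq' : (0 : ℚ) < q := by exact_mod_cast hq
  refine lukAt_congr fun x hx => ?_
  obtain ⟨a, -, rfl⟩ := (mem_Grid_iff hn).1 hx
  rw [div_le_div_iff_of_pos_right hn', Nat.cast_mul, div_le_div_iff₀ (by positivity) hn']
  have : (j : ℚ) * n ≤ a * (n * q) ↔ (j : ℚ) ≤ a * q := by
    rw [show (a : ℚ) * (n * q) = a * q * n by ring]
    exact mul_le_mul_iff_left₀ hn'
  rw [this]
  norm_cast
  constructor
  · exact fun h => hj'.trans (Nat.mul_le_mul_right q h)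
  · intro h
    by_contra hlt
    exact absurd (Nat.mul_le_mul_right q (show a ≤ i - 1 by omega)) (by omega)

theorem stronglyMaximal_and_axiomatized (hi : 0 < i) (hin : i ≤ n) (hq : q.Prime)
    (hr : q ^ r ∣ n) (hr' : ¬ q ^ (r + 1) ∣ n) (hj : (i - 1) * q < j) (hj' : j ≤ i * q) :
    (luk n i ⊓ lukBarAt (q ^ (r + 1)) ((j : ℚ) / ((n * q : ℕ) : ℚ))).StronglyMaximal
      (luk n i) ∧
    AxiomatizedWithExplosion
      (luk n i ⊓ lukBarAt (q ^ (r + 1)) ((j : ℚ) / ((n * q : ℕ) : ℚ))) n q (q ^ (r + 1)) j := by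
  have hn : 0 < n := hi.trans_le hin
  have hN : 0 < n * q := Nat.mul_pos hn hq.pos
  have hnN : n ∣ n * q := Nat.dvd_mul_right n q
  have hmN := prime_pow_dvd_mul hr
  have hj0 : 0 < j := (Nat.zero_le _).trans_lt hj
  have hjN : j ≤ n * q := hj'.trans (Nat.mul_le_mul_right q hin)
  have hN' : (0 : ℚ) < (n * q : ℕ) := by exact_mod_cast hN
  have hc0 : 0 < (j : ℚ) / (n * q : ℕ) := div_pos (by exact_mod_cast hj0) hN'
  have hc1 : (j : ℚ) / (n * q : ℕ) ≤ 1 := (div_le_one hN').2 (by exact_mod_cast hjN)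
  have hdvd : ∀ d, d ∣ n * q → d ∣ n ∨ q ^ (r + 1) ∣ d :=
    fun d => dvd_or_prime_pow_dvd hq hn hr
  rw [luk_eq_lukAt hi hn hq.pos hj hj']
  refine ⟨stronglyMaximal_inf hN hnN hmN hr' hdvd hc0 hc1, exists_finite_calculus hN hc0 hc1,
    ⟨_, isAxiomFor_charFm_union hN hnN hmN hc0 hc1⟩, ⟨_, isAxiomFor_charFm_Grid hN hnN hc0 hc1⟩,
    fun H γ' γ hH hγ' hγ => ?_⟩
  rw [hilbertLogic_union, hH]
  exact adjoin_explosionRule hN hnN hmN hr' hdvd hj0 hjN hγ' hγ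

/-! ### The strongly maximal logics -/

/-- The indicator of `Grid k`, built over the common multiple nk, is a theorem of the smaller logic
and must hold at 1/n. -/
theorem dvd_of_lukAt_le {k : ℕ} {c c' : ℚ} (hn : 0 < n) (hk : 0 < k) (hc1 : c ≤ 1) (hc0' : 0 < c')
    (h : lukAt k c ≤ lukAt n c') : n ∣ k := by
  by_contra hnk
  have hN : 0 < n * k := Nat.mul_pos hn hk
  exact not_lukAt_validates_charFm hN (Nat.dvd_mul_right n k) hc0'
    (fun hs => hnk ((inv_mem_Grid_iff hn).1 (hs ((inv_mem_Grid_iff hn).2 dvd_rfl))))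
    (Logic.Validates.mono h (lukAt_validates_charFm hN (Nat.dvd_mul_left k n) hc1 subset_rfl))

/-- In `lukAt k c` a variable is interderivable with the 0/1-valued indicator of its designation.
This passes to the larger logic, where the indicator still tests the old threshold. -/
theorem le_iff_le_of_lukAt_le {k : ℕ} {c c' : ℚ} (hk : 0 < k) (hnk : n ∣ k) (hc0 : 0 < c)
    (hc1 : c ≤ 1) (hc0' : 0 < c') (hc1' : c' ≤ 1) (h : lukAt k c ≤ lukAt n c') {x : ℚ}
    (hx : x ∈ Grid n) : c' ≤ x ↔ c ≤ x := by
  classical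
  have hchar : ∀ {e : ℕ → ℚ}, (∀ l, e l ∈ Grid k) →
      eval e (charFm hk {x | c ≤ x}) = if c ≤ e 0 then 1 else 0 :=
    fun {e} he => by by_cases h : c ≤ e 0 <;> simp [eval_charFm hk _ (he 0), h]
  have h₁ : (lukAt k c).Deriv {Fm.var 0} (charFm hk {x | c ≤ x}) := by
    refine lukAt_deriv.2 fun e he hΓ => ?_
    have h0 : c ≤ e 0 := hΓ _ rfl
    rwa [hchar he, if_pos h0]
  have h₂ : (lukAt k c).Deriv {charFm hk {x | c ≤ x}} (Fm.var 0) := by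
    refine lukAt_deriv.2 fun e he hΓ => ?_
    have h0 := hΓ _ rfl
    rw [hchar he] at h0
    by_contra hne
    exact (h0.trans_eq (if_neg hne)).not_gt hc0
  have hxk := Grid_mono hnk hx
  constructor
  · intro hle
    have := lukAt_deriv.1 (h _ _ h₁) (fun _ => x) (fun _ => hx) (by rintro _ rfl; exact hle)
    rw [hchar fun _ => hxk] at this
    by_contra hne
    exact (this.trans_eq (if_neg hne)).not_gt hc0'
  · intro hle
    refine lukAt_deriv.1 (h _ _ h₂) (fun _ => x) (fun _ => hx) ?_
    rintro _ rfl
    rwa [hchar fun _ => hxk, if_pos hle]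

theorem exists_prime_of_stronglyMaximal {L : Logic} {k j : ℕ} (hi : 0 < i) (hin : i ≤ n)
    (hj : 0 < j) (hjk : j ≤ k) (hL : luk k j ≤ L) (hs : L.StronglyMaximal (luk n i)) :
    ∃ q j r : ℕ, q.Prime ∧ (i - 1) * q < j ∧ j ≤ i * q ∧ q ^ r ∣ n ∧ ¬ q ^ (r + 1) ∣ n ∧
      L = luk n i ⊓ lukBarAt (q ^ (r + 1)) ((j : ℚ) / ((n * q : ℕ) : ℚ)) := by
  have hn : 0 < n := hi.trans_le hin
  have hk : 0 < k := hj.trans_le hjk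
  have hn' : (0 : ℚ) < n := by exact_mod_cast hn
  have hk' : (0 : ℚ) < k := by exact_mod_cast hk
  set c : ℚ := (j : ℚ) / k with hc
  have hc0 : 0 < c := div_pos (by exact_mod_cast hj) hk'
  have hc1 : c ≤ 1 := (div_le_one hk').2 (by exact_mod_cast hjk)
  have hd0 : 0 < (i : ℚ) / n := div_pos (by exact_mod_cast hi) hn'
  have hd1 : (i : ℚ) / n ≤ 1 := (div_le_one hn').2 (by exact_mod_cast hin)
  have hle : lukAt k c ≤ lukAt n ((i : ℚ) / n) := hL.trans hs.1.le
  have hnk : n ∣ k := dvd_of_lukAt_le hn hk hc1 hd0 hle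
  have hfil : ∀ x ∈ Grid n, (i : ℚ) / n ≤ x ↔ c ≤ x :=
    fun x hx => le_iff_le_of_lukAt_le hk hnk hc0 hc1 hd0 hd1 hle hx
  have hlukn : luk n i = lukAt n c := lukAt_congr hfil
  obtain ⟨Γ, φ, hd, hnd⟩ : ∃ Γ φ, (lukAt n c).Deriv Γ φ ∧ ¬ L.Deriv Γ φ := by
    by_contra hne
    push Not at hne
    exact hs.1.not_ge (hlukn ▸ hne)
  -- A counterexample that satisfies every `L`-consequence of Γ; without one, `deriv_of_refuting`
  -- would derive φ.
  obtain ⟨e, he, hΓ, hφ, hθ⟩ : ∃ e : ℕ → ℚ, (∀ k', e k' ∈ Grid k) ∧ (∀ ψ ∈ Γ, c ≤ eval e ψ) ∧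
      ¬ c ≤ eval e φ ∧ ∀ θ, L.Deriv Γ θ → c ≤ eval e θ := by
    by_contra hne
    push Not at hne
    exact hnd (deriv_of_refuting hL fun e he hΓ hφ => by
      obtain ⟨θ, hθ, h⟩ := hne e he hΓ (not_le.1 hφ)
      exact ⟨θ, hθ, h.not_ge⟩)
  obtain ⟨M, hM, hMk, ⟨t, ht⟩, heM⟩ := exists_generator hk he
  obtain ⟨q, r, hq, hr, hr', hrM⟩ :=
    exists_prime_pow_dvd_of_not_dvd (not_generator_dvd hd heM hΓ hφ)
  have hq' : (0 : ℚ) < q := by exact_mod_cast hq.pos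
  have hN : 0 < n * q := Nat.mul_pos hn hq.pos
  have hNk : n * q ∣ k := mul_prime_dvd hq hr hr' hnk (hrM.trans hMk)
  have hN' : (0 : ℚ) < (n * q : ℕ) := by exact_mod_cast hN
  -- The least numerator over nq that reaches `c`, so j'/(nq) and `c` make the same cut in `Grid (n
  -- * q)`.
  set j' : ℕ := ⌈c * (n * q : ℕ)⌉₊ with hj'
  have hlow : ((i - 1 : ℕ) : ℚ) / n < c := by
    by_contra hne
    have hmem : ((i - 1 : ℕ) : ℚ) / n ∈ Grid n := (mem_Grid_iff hn).2 ⟨i - 1, by omega, rfl⟩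
    have := (hfil _ hmem).2 (not_lt.1 hne)
    rw [div_le_div_iff_of_pos_right hn', Nat.cast_le] at this
    omega
  have hup : c ≤ (i : ℚ) / n := (hfil _ ((mem_Grid_iff hn).2 ⟨i, hin, rfl⟩)).1 le_rfl
  have hjl : (i - 1) * q < j' := by
    rw [hj', Nat.lt_ceil]
    rw [div_lt_iff₀ hn'] at hlow
    have := mul_lt_mul_of_pos_right hlow hq'
    push_cast
    linarith
  have hju : j' ≤ i * q := by
    rw [hj', Nat.ceil_le]
    rw [le_div_iff₀ hn'] at hup
    have := mul_le_mul_of_nonneg_right hup hq'.le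
    push_cast
    linarith
  refine ⟨q, j', r, hq, hjl, hju, hr, hr', ?_⟩
  obtain ⟨hmax, -⟩ := stronglyMaximal_and_axiomatized hi hin hq hr hr' hjl hju
  have hbar : lukBarAt (q ^ (r + 1)) ((j' : ℚ) / (n * q : ℕ)) = lukBarAt (q ^ (r + 1)) c := by
    refine lukBarAt_congr (div_pos ?_ hN') ((div_le_one hN').2 ?_) hc0 hc1 fun x hx => ?_
    · exact_mod_cast (Nat.zero_le _).trans_lt hjl
    · exact_mod_cast hju.trans (Nat.mul_le_mul_right q hin)
    · obtain ⟨a, -, rfl⟩ := (mem_Grid_iff hN).1 (Grid_mono (prime_pow_dvd_mul hr) hx)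
      rw [div_le_div_iff_of_pos_right hN', Nat.cast_le, hj', Nat.ceil_le, le_div_iff₀ hN']
  rw [hbar] at hmax ⊢
  have hLn : L ≤ lukAt n c := hlukn ▸ hs.1.le
  -- A rule of `L` failing in the bar matrix would yield an `L`-theorem refuted at the unrefuted
  -- point `e`.
  have hLbar : L ≤ lukBarAt (q ^ (r + 1)) c := by
    intro Δ ψ hψ
    by_contra hne
    obtain ⟨e₁, e₂, h₁, h₂, hΔ, hψe⟩ := exists_counterexample_lukBarAt
      (hLn.trans (lukAt_le_lukAt (one_dvd n) c)) hc0 hc1 hψ hne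
    obtain ⟨θ, hLθ, hθe⟩ := exists_refuted_theorem hk hM hL hψ
      (fun k => Grid_mono hrM (h₁ k)) h₂ hΔ hψe he ht
    exact hθe (hθ θ (hLθ Γ))
  have hLinf : L ≤ luk n i ⊓ lukBarAt (q ^ (r + 1)) c :=
    fun Δ ψ h => ⟨hs.1.le Δ ψ h, hLbar Δ ψ h⟩
  refine le_antisymm hLinf ?_
  -- If the inclusion were proper, a finitary rule of the intersection missing from `L` would
  -- generate `luk n i` over `L`, yet stay inside the intersection.
  by_contra hne
  obtain ⟨ρ, hρ, hρL⟩ := ((finitary_lukAt hn _).inf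
    (finitary_lukBarAt (Nat.pow_pos hq.pos) c)).exists_rule hne
  refine hmax.1.not_ge ?_
  calc luk n i = L.adjoin {ρ} := (hs.2 ρ hρ.1 hρL).symm
    _ ≤ _ := Logic.adjoin_le hLinf (by rintro _ rfl; exact hρ)

end PrimePower

end Luk

theorem mainTheorem10 (n i : ℕ) (hi : 0 < i) (hin : i ≤ n) :
    (∀ q : ℕ, q.Prime → ¬ q ∣ n → ∀ j : ℕ, (i - 1) * q < j → j ≤ i * q →
      (luk n i ⊓ lukBarAt q ((j : ℚ) / ((n * q : ℕ) : ℚ))).StronglyMaximal (luk n i) ∧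
      AxiomatizedWithExplosion (luk n i ⊓ lukBarAt q ((j : ℚ) / ((n * q : ℕ) : ℚ))) n q q j) ∧
    (∀ q r : ℕ, q.Prime → q ^ r ∣ n → ¬ q ^ (r + 1) ∣ n →
      ∀ j : ℕ, (i - 1) * q < j → j ≤ i * q →
      (luk n i ⊓ lukBarAt (q ^ (r + 1)) ((j : ℚ) / ((n * q : ℕ) : ℚ))).StronglyMaximal
        (luk n i) ∧
      AxiomatizedWithExplosion
        (luk n i ⊓ lukBarAt (q ^ (r + 1)) ((j : ℚ) / ((n * q : ℕ) : ℚ))) n q (q ^ (r + 1)) j) ∧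
    (∀ L : Logic, L.Finitary → (∃ k j : ℕ, 0 < j ∧ j ≤ k ∧ luk k j ≤ L) →
      (L.StronglyMaximal (luk n i) ↔
        ∃ q j : ℕ, q.Prime ∧ (i - 1) * q < j ∧ j ≤ i * q ∧
          ((¬ q ∣ n ∧ L = luk n i ⊓ lukBarAt q ((j : ℚ) / ((n * q : ℕ) : ℚ))) ∨
            ∃ r : ℕ, q ^ r ∣ n ∧ ¬ q ^ (r + 1) ∣ n ∧
              L = luk n i ⊓ lukBarAt (q ^ (r + 1)) ((j : ℚ) / ((n * q : ℕ) : ℚ))))) := by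
  refine ⟨fun q hq hqn j hj hj' => ?_, fun q r hq hr hr' j hj hj' =>
    stronglyMaximal_and_axiomatized hi hin hq hr hr' hj hj', fun L _ ⟨k, j, hj, hjk, hL⟩ =>
    ⟨fun hs => ?_, ?_⟩⟩
  -- The case q ∤ n is the prime power case with exponent r = 0.
  · have h := stronglyMaximal_and_axiomatized (r := 0) hi hin hq (by simp) (by simpa using hqn)
      hj hj'
    rwa [zero_add, pow_one] at h
  · obtain ⟨q, j, r, hq, hj, hj', hr, hr', h⟩ :=
      exists_prime_of_stronglyMaximal hi hin hj hjk hL hs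
    exact ⟨q, j, hq, hj, hj', Or.inr ⟨r, hr, hr', h⟩⟩
  · rintro ⟨q, j, hq, hj, hj', ⟨hqn, rfl⟩ | ⟨r, hr, hr', rfl⟩⟩
    · have h := stronglyMaximal_and_axiomatized (r := 0) hi hin hq (by simp) (by simpa using hqn)
        hj hj'
      rw [zero_add, pow_one] at h
      exact h.1
    · exact (stronglyMaximal_and_axiomatized hi hin hq hr hr' hj hj').1
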